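/- Let $b>0$ and $n\in\mathbb N$, and let $\mathbb{R}_n[x]$ be the space of real polynomials of degree at most $n$. Put $\Delta_b p(x) := \frac{p(x)-p(x-b)}{b}$ and, for $p,r\in\mathbb{R}_n[x]$, $$p \boxplus_b^n r := \sum_{k=0}^n \Delta_b^k p\cdot(\Delta_b^{n-k} r)(0).$$ A nonzero polynomial $p\in\mathbb{R}[x]$ is called $b$-mesh if all its roots are real and any two of its roots, listed with multiplicity, are at distance at least $b$. For $p,q\in\mathbb{R}[x]$ write $p\ll q$ if $p'(x)q(x)-p(x)q'(x)\le 0$ for all $x\in\mathbb{R}$. We say that the roots of two nonzero polynomials interlace if both polynomials are real-rooted and their roots, listed in increasing order with multiplicity as $a_0\le a_1\le\dots$ for one of them and $b_0\le b_1\le\dots$ for the other, satisfy $a_0\le b_0\le a_1\le b_1\le\dots$ for one of the two choices of naming, where the degrees are equal or the polynomial with roots $a_i$ has one root more. **Theorem 1.4.** Let $f,g\in\mathbb{R}_n[x]$ be $b$-mesh polynomials of degree exactly $n$, and let $T_g:\mathbb{R}_n[x]\to\mathbb{R}_n[x]$ be the real linear operator $T_g(r) := r\boxplus_b^n g$. Then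 $T_g$ preserves interlacing with respect to $f$: for every $r\in\mathbb{R}_n[x]$, 1. $r\ll f$ implies $T_g(r)\ll T_g(f)$, and $f\ll r$ implies $T_g(f)\ll T_g(r)$; 2. if the roots of $r$ interlace the roots of $f$, then $T_g(r)$ and $T_g(f)$ are real-rooted and the roots of $T_g(r)$ interlace the roots of $T_g(f)$. -/

import Mathlib

open Polynomial

noncomputable section

/-- The backward finite difference operator `Δ_b p = (p(x) - p(x - b)) / b`. -/
def finDiff (b : ℝ) (p : ℝ[X]) : ℝ[X] :=
  C b⁻¹ * (p - p.comp (X - C b))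

/-- The `b`-additive convolution
`p ⊞_b^n r = ∑_{k=0}^n (Δ_b^k p) · (Δ_b^{n-k} r)(0)`. -/
def bAddConv (b : ℝ) (n : ℕ) (p r : ℝ[X]) : ℝ[X] :=
  ∑ k ∈ Finset.range (n + 1), (finDiff b)^[k] p * C (((finDiff b)^[n - k] r).eval 0)

/-- `p` is `b`-mesh: it is a nonzero polynomial with only real roots, and any two of its roots
(listed with multiplicity) are at distance at least `b`. -/
def IsMesh (b : ℝ) (p : ℝ[X]) : Prop :=
  p ≠ 0 ∧ p.Splits ∧ ∀ x ∈ p.roots, ∀ y ∈ p.roots.erase x, b ≤ |x - y|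

/-- The relation `f ≪ g`: the polynomial `f' g - f g'` is nonpositive on the real line. -/
def InterlacesLE (f g : ℝ[X]) : Prop :=
  ∀ x : ℝ, (derivative f * g - f * derivative g).eval x ≤ 0

/-- The linear operator `T : ℝ_n[x] → ℝ[x]` preserves interlacing with respect to `f`. -/
def PreservesInterlacing (n : ℕ) (T : degreeLE ℝ n →ₗ[ℝ] ℝ[X]) (f : degreeLE ℝ n) : Prop :=
  ∀ r : degreeLE ℝ n,
    (InterlacesLE r f → InterlacesLE (T r) (T f)) ∧
    (InterlacesLE f r → InterlacesLE (T f) (T r))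

/-- `f` and `g` are nonzero and real-rooted, and their roots with multiplicity, `a₀ ≤ a₁ ≤ …` for
`f` and `b₀ ≤ b₁ ≤ …` for `g`, satisfy `a₀ ≤ b₀ ≤ a₁ ≤ b₁ ≤ …`, each root of one being followed by
a root of the other until both lists are exhausted. The sequence `c` is the merged list
`a₀, b₀, a₁, b₁, …`, continued in an arbitrary monotone way. -/
def RootsAlternate (f g : ℝ[X]) : Prop :=
  f ≠ 0 ∧ g ≠ 0 ∧ (f.natDegree = g.natDegree ∨ f.natDegree = g.natDegree + 1) ∧
    ∃ c : ℕ → ℝ, Monotone c ∧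
      f.roots = (Multiset.range f.natDegree).map (fun i => c (2 * i)) ∧
      g.roots = (Multiset.range g.natDegree).map (fun i => c (2 * i + 1))

/-- `f` and `g` are nonzero real-rooted polynomials whose roots interlace (weakly). -/
def RootsInterlace (f g : ℝ[X]) : Prop :=
  RootsAlternate f g ∨ RootsAlternate g f

/- Helper facts: `ℝ_n[x]` is stable under `r ↦ r ⊞_b^n g`, and this map is linear. -/

theorem finDiff_add (b : ℝ) (p q : ℝ[X]) : finDiff b (p + q) = finDiff b p + finDiff b q := by
  simp only [finDiff, add_comp]; ring

theorem finDiff_smul (b a : ℝ) (p : ℝ[X]) : finDiff b (a • p) = a • finDiff b p := by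
  simp only [finDiff, smul_eq_C_mul, mul_comp, C_comp]; ring

theorem finDiff_mem (b : ℝ) (n : ℕ) {p : ℝ[X]} (hp : p ∈ degreeLE ℝ (n : WithBot ℕ)) :
    finDiff b p ∈ degreeLE ℝ (n : WithBot ℕ) := by
  have hq : p.comp (X - C b) ∈ degreeLE ℝ (n : WithBot ℕ) := by
    rw [mem_degreeLE, ← natDegree_le_iff_degree_le] at *
    rwa [natDegree_comp, natDegree_X_sub_C, mul_one]
  have := Submodule.smul_mem _ b⁻¹ (Submodule.sub_mem _ hp hq)
  rwa [smul_eq_C_mul] at this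

theorem finDiff_iterate_add (b : ℝ) (k : ℕ) (p q : ℝ[X]) :
    (finDiff b)^[k] (p + q) = (finDiff b)^[k] p + (finDiff b)^[k] q := by
  induction k with
  | zero => rfl
  | succ k ih => simp only [Function.iterate_succ_apply', ih, finDiff_add]

theorem finDiff_iterate_smul (b : ℝ) (k : ℕ) (a : ℝ) (p : ℝ[X]) :
    (finDiff b)^[k] (a • p) = a • (finDiff b)^[k] p := by
  induction k with
  | zero => rfl
  | succ k ih => simp only [Function.iterate_succ_apply', ih, finDiff_smul]

theorem finDiff_iterate_mem (b : ℝ) (n k : ℕ) {p : ℝ[X]}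
    (hp : p ∈ degreeLE ℝ (n : WithBot ℕ)) :
    (finDiff b)^[k] p ∈ degreeLE ℝ (n : WithBot ℕ) := by
  induction k with
  | zero => exact hp
  | succ k ih => rw [Function.iterate_succ_apply']; exact finDiff_mem b n ih

theorem bAddConv_mem (b : ℝ) (n : ℕ) {p : ℝ[X]} (r : ℝ[X])
    (hp : p ∈ degreeLE ℝ (n : WithBot ℕ)) :
    bAddConv b n p r ∈ degreeLE ℝ (n : WithBot ℕ) := by
  refine Submodule.sum_mem _ fun k _ => ?_
  rw [mul_comm, ← smul_eq_C_mul]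
  exact Submodule.smul_mem _ _ (finDiff_iterate_mem b n k hp)

/-- The real linear operator `T_g : ℝ_n[x] → ℝ_n[x]`, `T_g r = r ⊞_b^n g`. -/
def convOp (b : ℝ) (n : ℕ) (g : ℝ[X]) :
    degreeLE ℝ (n : WithBot ℕ) →ₗ[ℝ] degreeLE ℝ (n : WithBot ℕ) where
  toFun r := ⟨bAddConv b n r g, bAddConv_mem b n g r.2⟩
  map_add' p q := by
    ext1
    simp only [bAddConv, Submodule.coe_add, finDiff_iterate_add, add_mul,
      Finset.sum_add_distrib]
  map_smul' a p := by
    ext1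
    simp only [bAddConv, Submodule.coe_smul, finDiff_iterate_smul, smul_mul_assoc,
      Finset.smul_sum, RingHom.id_apply]

end

open Polynomial

noncomputable section

/-! ### Finite differences: degrees, determinacy at `0`, product rule -/

section FiniteDifference

variable {b : ℝ}

/-! Let `f` have simple real roots. Lagrange interpolation writes each `r` of degree at most `n` as
`c f + ∑ c_a f/(x - a)`, with `c_a = r(a)/f'(a)` and `a` running over the roots of `f`; then `r ≪ f`
says exactly that every `c_a` is nonnegative. As the Wronskian `W` is bilinear and alternating, it
is enough to prove `T_g(f/(x - a)) ≪ T_g(f)` for each root `a`.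

Put `h = f/(x - a)` and `n = m + 1`. The product rule for `Δ_b` gives `T_g(f) = (x - a) u + v`,
where `u = h ⊞^m Δ_b g = T_g(h)` and `v = h ⊞^m polarDiff g`. Hence `W(u, T_g(f)) = u² + W(u, v)`.
The convolution is commutative, so `u` and `v` are the images of `Δ_b g` and `polarDiff g` under
`T_h` at level `m`. Since `Δ_b g` is again `b`-mesh and `Δ_b g ≪ polarDiff g`, induction on `n`
gives `W(u, v) ≥ 0`. This is `sq_le_wronskian_bAddConv`.

For the roots, the term `u²` excludes multiple roots of `T_g(f)`, and `x - a + v/u` has no zero off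
the real line, so `T_g(f)` has simple real roots (`bAddConv_eq_rootPoly`). Relative to such a
polynomial, `≪` is a sign condition at its roots, which up to the sign of `r` amounts to interlacing
of roots (`RootsInterlace.interlacesLE`, `rootsInterlace_of_sign`). -/

theorem eval_finDiff (b x : ℝ) (p : ℝ[X]) :
    (finDiff b p).eval x = b⁻¹ * (p.eval x - p.eval (x - b)) := by
  simp [finDiff]

theorem eval_sub_step (hb : b ≠ 0) (x : ℝ) (p : ℝ[X]) :
    p.eval (x - b) = p.eval x - b * (finDiff b p).eval x := by
  rw [eval_finDiff]; field_simp; ring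

theorem comp_eq_sub_finDiff (hb : b ≠ 0) (p : ℝ[X]) :
    p.comp (X - C b) = p - C b * finDiff b p := by
  have : (C b * C b⁻¹ : ℝ[X]) = 1 := by rw [← C_mul, mul_inv_cancel₀ hb, C_1]
  rw [finDiff, ← mul_assoc, this]; ring

theorem finDiff_iterate_zero (b : ℝ) (k : ℕ) : (finDiff b)^[k] 0 = 0 := by
  simpa using finDiff_iterate_smul b k 0 0

theorem finDiff_iterate_C_mul (b : ℝ) (k : ℕ) (a : ℝ) (p : ℝ[X]) :
    (finDiff b)^[k] (C a * p) = C a * (finDiff b)^[k] p := by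
  simpa only [smul_eq_C_mul] using finDiff_iterate_smul b k a p

theorem finDiff_iterate_sub (b : ℝ) (k : ℕ) (p q : ℝ[X]) :
    (finDiff b)^[k] (p - q) = (finDiff b)^[k] p - (finDiff b)^[k] q := by
  have := finDiff_iterate_add b k p (C (-1) * q)
  rw [finDiff_iterate_C_mul] at this
  simpa [sub_eq_add_neg] using this

theorem finDiff_C (b a : ℝ) : finDiff b (C a) = 0 := by simp [finDiff]

/-- The coefficients of `p(x - b)` are Hasse derivatives of `p` at `-b`. The `i`-th is constant for
`i > n` and cancels; for `i = n` it is affine and only its linear term survives. -/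
theorem coeff_finDiff_of_natDegree_le (hb : b ≠ 0) {n : ℕ} {p : ℝ[X]}
    (hp : p.natDegree ≤ n + 1) :
    (finDiff b p).natDegree ≤ n ∧ (finDiff b p).coeff n = (n + 1) * p.coeff (n + 1) := by
  have ht : p.comp (X - C b) = taylor (-b) p := by rw [taylor_apply, C_neg, sub_eq_add_neg]
  have key : ∀ i, (finDiff b p).coeff i = b⁻¹ * (p.coeff i - (hasseDeriv i p).eval (-b)) := by
    intro i
    rw [finDiff, coeff_C_mul, coeff_sub, ht, taylor_coeff]
  constructor
  · rw [natDegree_le_iff_coeff_eq_zero]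
    intro i hi
    rw [key]
    have h0 : (hasseDeriv i p).natDegree = 0 := by
      have := natDegree_hasseDeriv_le p i
      omega
    rw [eq_C_of_natDegree_eq_zero h0, eval_C, hasseDeriv_coeff]
    simp
  · rw [key]
    have h1 : (hasseDeriv n p).natDegree ≤ 1 := by
      have := natDegree_hasseDeriv_le p n
      omega
    rw [eq_X_add_C_of_natDegree_le_one h1, hasseDeriv_coeff, hasseDeriv_coeff]
    simp [add_comm 1 n]
    field_simp

theorem natDegree_finDiff_iterate_le (hb : b ≠ 0) {n : ℕ} {p : ℝ[X]} (hp : p.natDegree ≤ n)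
    (k : ℕ) : ((finDiff b)^[k] p).natDegree ≤ n - k := by
  induction k with
  | zero => simpa using hp
  | succ k ih =>
    rw [Function.iterate_succ_apply']
    rcases Nat.eq_zero_or_pos (n - k) with h | h
    · rw [eq_C_of_natDegree_eq_zero (by omega : ((finDiff b)^[k] p).natDegree = 0), finDiff_C]
      simp
    · exact (coeff_finDiff_of_natDegree_le hb (n := n - (k + 1)) (by omega)).1

theorem finDiff_iterate_eq_zero (hb : b ≠ 0) {n : ℕ} {p : ℝ[X]} (hp : p.natDegree ≤ n)
    {k : ℕ} (hk : n < k) : (finDiff b)^[k] p = 0 := by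
  obtain ⟨j, rfl⟩ := Nat.exists_eq_add_of_lt hk
  have h := natDegree_finDiff_iterate_le hb hp n
  rw [show n + j + 1 = j + (1 + n) by ring, Function.iterate_add_apply,
    Function.iterate_add_apply, Function.iterate_one,
    eq_C_of_natDegree_eq_zero (by omega : ((finDiff b)^[n] p).natDegree = 0), finDiff_C,
    finDiff_iterate_zero]

theorem finDiff_iterate_natDegree (hb : b ≠ 0) {n : ℕ} {p : ℝ[X]} (hp : p.natDegree ≤ n) :
    (finDiff b)^[n] p = C (n.factorial * p.coeff n) := by
  induction n generalizing p with
  | zero =>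
    rw [Function.iterate_zero_apply]
    conv_lhs => rw [eq_C_of_natDegree_eq_zero (Nat.le_zero.1 hp)]
    simp
  | succ n ih =>
    obtain ⟨h1, h2⟩ := coeff_finDiff_of_natDegree_le hb hp
    rw [Function.iterate_succ_apply, ih h1, h2, Nat.factorial_succ]
    push_cast
    congr 1
    ring

/-- A polynomial is determined by its iterated differences at `0`. -/
theorem eq_zero_of_finDiff_iterate_eval (hb : b ≠ 0) {p : ℝ[X]}
    (hp : ∀ j, ((finDiff b)^[j] p).eval 0 = 0) : p = 0 := by
  -- The differences at `0` determine those at `-b`, then at `-2b`, and so on, so `p` vanishes at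
  -- infinitely many points.
  have key : ∀ k j : ℕ, ((finDiff b)^[j] p).eval (-(k * b)) = 0 := by
    intro k
    induction k with
    | zero => simpa using hp
    | succ k ih =>
      intro j
      have := eval_sub_step hb (-(k * b)) ((finDiff b)^[j] p)
      rw [← Function.iterate_succ_apply' (finDiff b), ih, ih] at this
      rw [show -(((k + 1 : ℕ) : ℝ) * b) = -(k * b) - b by push_cast; ring, this]
      simp
  refine eq_zero_of_infinite_isRoot p
    (Set.infinite_of_injective_forall_mem (f := fun k : ℕ => -((k : ℝ) * b)) ?_ fun k => key k 0)
  intro i j h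
  have : (i : ℝ) = j := mul_right_cancel₀ hb (neg_injective h)
  exact_mod_cast this

theorem finDiff_iterate_comp (b : ℝ) (k : ℕ) (p : ℝ[X]) :
    (finDiff b)^[k] (p.comp (X - C b)) = ((finDiff b)^[k] p).comp (X - C b) := by
  induction k generalizing p with
  | zero => rfl
  | succ k ih =>
    have : finDiff b (p.comp (X - C b)) = (finDiff b p).comp (X - C b) := by
      simp [finDiff]
    rw [Function.iterate_succ_apply, this, ih, ← Function.iterate_succ_apply]

theorem finDiff_linear_mul (hb : b ≠ 0) (a : ℝ) (p : ℝ[X]) :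
    finDiff b ((X - C a) * p) = (X - C a) * finDiff b p + p.comp (X - C b) := by
  have : (C b⁻¹ * C b : ℝ[X]) = 1 := by rw [← C_mul, inv_mul_cancel₀ hb, C_1]
  simp only [finDiff, mul_comp, sub_comp, X_comp, C_comp]
  linear_combination (p.comp (X - C b)) * this

theorem finDiff_iterate_linear_mul (hb : b ≠ 0) (a : ℝ) (p : ℝ[X]) (k : ℕ) :
    (finDiff b)^[k + 1] ((X - C a) * p) =
      (X - C a) * (finDiff b)^[k + 1] p + C (k + 1 : ℝ) * ((finDiff b)^[k] p).comp (X - C b) := by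
  induction k with
  | zero => simpa using finDiff_linear_mul hb a p
  | succ k ih =>
    rw [Function.iterate_succ_apply' _ (k + 1), ih, finDiff_add, finDiff_linear_mul hb,
      Function.iterate_succ_apply' _ (k + 1), ← smul_eq_C_mul, finDiff_smul, smul_eq_C_mul,
      ← Function.iterate_one (finDiff b), finDiff_iterate_comp, Function.iterate_one,
      ← Function.iterate_succ_apply' (finDiff b) k]
    push_cast
    simp only [C_add, C_1]
    ring

end FiniteDifference

/-! ### Algebra of the convolution -/

section Convolution

variable {b : ℝ}

/-- `r ↦ r ⊞_b^n g` as a linear operator on all polynomials. -/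
def bAddConvLin (b : ℝ) (n : ℕ) (g : ℝ[X]) : ℝ[X] →ₗ[ℝ] ℝ[X] where
  toFun r := bAddConv b n r g
  map_add' p q := by
    simp only [bAddConv, finDiff_iterate_add, add_mul, Finset.sum_add_distrib]
  map_smul' a p := by
    simp only [bAddConv, finDiff_iterate_smul, smul_mul_assoc, Finset.smul_sum, RingHom.id_apply]

theorem bAddConvLin_apply (b : ℝ) (n : ℕ) (g r : ℝ[X]) :
    bAddConvLin b n g r = bAddConv b n r g := rfl

theorem finDiff_iterate_sum (b : ℝ) (j : ℕ) {ι : Type*} (s : Finset ι) (F : ι → ℝ[X]) :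
    (finDiff b)^[j] (∑ i ∈ s, F i) = ∑ i ∈ s, (finDiff b)^[j] (F i) := by
  classical
  induction s using Finset.induction_on with
  | empty => simp [finDiff_iterate_zero]
  | insert a s ha ih => rw [Finset.sum_insert ha, Finset.sum_insert ha, finDiff_iterate_add, ih]

theorem eval_finDiff_iterate_bAddConv (n j : ℕ) (p q : ℝ[X]) :
    ((finDiff b)^[j] (bAddConv b n p q)).eval 0 =
      ∑ k ∈ Finset.range (n + 1),
        ((finDiff b)^[j + k] p).eval 0 * ((finDiff b)^[n - k] q).eval 0 := by
  rw [bAddConv, finDiff_iterate_sum, eval_finsetSum]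
  refine Finset.sum_congr rfl fun k _ => ?_
  rw [mul_comm, finDiff_iterate_C_mul, eval_mul, eval_C, Function.iterate_add_apply, mul_comm]

/-- Compare `j`-th differences at `0`. Once the vanishing terms with `j + k > n` are dropped, the
sum is symmetric under `k ↦ n - j - k`. -/
theorem bAddConv_comm (hb : b ≠ 0) {n : ℕ} {p q : ℝ[X]} (hp : p.natDegree ≤ n)
    (hq : q.natDegree ≤ n) : bAddConv b n p q = bAddConv b n q p := by
  rw [← sub_eq_zero]
  refine eq_zero_of_finDiff_iterate_eval hb fun j => ?_
  rw [finDiff_iterate_sub, eval_sub, eval_finDiff_iterate_bAddConv, eval_finDiff_iterate_bAddConv,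
    sub_eq_zero]
  have key : ∀ p q : ℝ[X], p.natDegree ≤ n →
      ∑ k ∈ Finset.range (n + 1),
        ((finDiff b)^[j + k] p).eval 0 * ((finDiff b)^[n - k] q).eval 0 =
      ∑ k ∈ Finset.range (n + 1 - j),
        ((finDiff b)^[j + k] p).eval 0 * ((finDiff b)^[n - k] q).eval 0 := by
    intro p q hp
    symm
    refine Finset.sum_subset (Finset.range_mono (by omega)) fun k hk hk' => ?_
    rw [Finset.mem_range] at hk hk'
    rw [finDiff_iterate_eq_zero hb hp (by omega)]
    simp
  rw [key p q hp, key q p hq, ← Finset.sum_range_reflect]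
  refine Finset.sum_congr rfl fun k hk => ?_
  rw [Finset.mem_range] at hk
  rw [mul_comm, show j + (n + 1 - j - 1 - k) = n - k by omega,
    show n - (n + 1 - j - 1 - k) = j + k by omega]

theorem bAddConv_succ_of_natDegree_le (hb : b ≠ 0) {m : ℕ} {p : ℝ[X]} (hp : p.natDegree ≤ m)
    (g : ℝ[X]) : bAddConv b (m + 1) p g = bAddConv b m p (finDiff b g) := by
  rw [bAddConv, Finset.sum_range_succ, finDiff_iterate_eq_zero hb hp (Nat.lt_succ_self m),
    zero_mul, add_zero, bAddConv]
  refine Finset.sum_congr rfl fun k hk => ?_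
  rw [Finset.mem_range] at hk
  rw [← Function.iterate_succ_apply, show (m - k).succ = m + 1 - k by omega]

/-- The polar companion `n g(x - b) - (x - b) Δ_b g` of `g`. -/
def polarDiff (b : ℝ) (n : ℕ) (g : ℝ[X]) : ℝ[X] :=
  C (n : ℝ) * g.comp (X - C b) - (X - C b) * finDiff b g

/-- The coefficients of degree `m + 1` cancel: the factor `m + 1` in front of `g(x - b)` matches the
one produced by `Δ_b`. -/
theorem natDegree_polarDiff_le (hb : b ≠ 0) {m : ℕ} {g : ℝ[X]} (hg : g.natDegree ≤ m + 1) :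
    (polarDiff b (m + 1) g).natDegree ≤ m := by
  obtain ⟨h1, h2⟩ := coeff_finDiff_of_natDegree_le hb hg
  rw [natDegree_le_iff_coeff_eq_zero]
  intro i hi
  obtain ⟨i, rfl⟩ : ∃ k, i = k + 1 := ⟨i - 1, by omega⟩
  rw [polarDiff, comp_eq_sub_finDiff hb, coeff_sub, coeff_C_mul, coeff_sub, coeff_C_mul, sub_mul,
    coeff_sub, coeff_X_mul, coeff_C_mul,
    coeff_eq_zero_of_natDegree_lt (p := finDiff b g) (n := i + 1) (by omega)]
  rcases eq_or_lt_of_le (Nat.le_of_lt_succ hi) with h | h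
  · subst h
    rw [h2]; push_cast; ring
  · rw [coeff_eq_zero_of_natDegree_lt (p := finDiff b g) (n := i) (by omega),
      coeff_eq_zero_of_natDegree_lt (p := g) (n := i + 1) (by omega)]
    ring

theorem eval_finDiff_iterate_polarDiff (hb : b ≠ 0) (n i : ℕ) (g : ℝ[X]) :
    ((finDiff b)^[i] (polarDiff b n g)).eval 0 =
      (n - i) * ((finDiff b)^[i] g).eval 0 -
        b * (n - i - 1) * ((finDiff b)^[i + 1] g).eval 0 := by
  have hs : ∀ q : ℝ[X], (q.comp (X - C b)).eval 0 = q.eval 0 - b * (finDiff b q).eval 0 := by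
    intro q
    rw [comp_eq_sub_finDiff hb]; simp
  rw [polarDiff, finDiff_iterate_sub, finDiff_iterate_C_mul, finDiff_iterate_comp]
  rcases i with _ | i
  · rw [eval_sub, eval_mul, eval_C, hs]
    simp
    ring
  · rw [finDiff_iterate_linear_mul hb, eval_sub, eval_mul, eval_C, hs, eval_add, eval_mul, eval_mul,
      eval_C, hs, ← Function.iterate_succ_apply' (finDiff b), ← Function.iterate_succ_apply' (finDiff b),
      ← Function.iterate_succ_apply (finDiff b), ← Function.iterate_succ_apply (finDiff b)]
    simp only [Nat.succ_eq_add_one, eval_sub, eval_X, eval_C]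
    push_cast
    ring

/-- The recursion behind both inductions. The product rule leaves the terms `(k + 1) (Δ^k h)(x -
b)`; expanding the shift as `1 - b Δ_b` and reindexing turns them into a convolution with the polar
companion. -/
theorem bAddConv_linear_mul (hb : b ≠ 0) {m : ℕ} (a : ℝ) {h : ℝ[X]} (hh : h.natDegree ≤ m)
    (g : ℝ[X]) :
    bAddConv b (m + 1) ((X - C a) * h) g =
      (X - C a) * bAddConv b (m + 1) h g + bAddConv b m h (polarDiff b (m + 1) g) := by
  set c : ℕ → ℝ := fun i => ((finDiff b)^[i] g).eval 0 with hc
  have h1 : bAddConv b (m + 1) ((X - C a) * h) g = (X - C a) * bAddConv b (m + 1) h g +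
      ∑ k ∈ Finset.range (m + 1),
        C ((k + 1) * c (m - k)) * ((finDiff b)^[k] h - C b * (finDiff b)^[k + 1] h) := by
    rw [bAddConv, bAddConv, Finset.sum_range_succ', Finset.sum_range_succ' _ (m + 1), mul_add,
      Finset.mul_sum, add_right_comm, ← Finset.sum_add_distrib]
    congr 1
    · refine Finset.sum_congr rfl fun k _ => ?_
      rw [finDiff_iterate_linear_mul hb, comp_eq_sub_finDiff hb, ← Function.iterate_succ_apply' (finDiff b) k,
        Nat.add_sub_add_right, C_mul]
      ring
    · simp [mul_assoc]
  have h2 : bAddConv b m h (polarDiff b (m + 1) g) =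
      ∑ k ∈ Finset.range (m + 1),
        C ((k + 1) * c (m - k) - b * k * c (m + 1 - k)) * (finDiff b)^[k] h := by
    rw [bAddConv]
    refine Finset.sum_congr rfl fun k hk => ?_
    have hk' : k ≤ m := Nat.lt_succ_iff.1 (Finset.mem_range.1 hk)
    rw [eval_finDiff_iterate_polarDiff hb, mul_comm, show m - k + 1 = m + 1 - k by omega,
      Nat.cast_sub hk']
    congr 2
    push_cast
    ring
  rw [h1, h2]
  congr 1
  -- Index shift: the last summand on the left vanishes because `h` has degree at most `m`, the
  -- first on the right because of the factor `k`.
  have h3 : ∑ k ∈ Finset.range (m + 1), C ((k + 1) * c (m - k)) * (C b * (finDiff b)^[k + 1] h) =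
      ∑ k ∈ Finset.range (m + 1), C (b * k * c (m + 1 - k)) * (finDiff b)^[k] h := by
    rw [Finset.sum_range_succ, Finset.sum_range_succ', finDiff_iterate_eq_zero hb hh
      (Nat.lt_succ_self m)]
    simp only [Nat.cast_zero, mul_zero, zero_mul, C_0, add_zero]
    refine Finset.sum_congr rfl fun k _ => ?_
    rw [← mul_assoc, ← C_mul, Nat.add_sub_add_right]
    congr 2
    push_cast
    ring
  simp only [mul_sub, Finset.sum_sub_distrib, C_sub, sub_mul]
  rw [h3]

theorem natDegree_bAddConv_le (hb : b ≠ 0) {n d : ℕ} {p : ℝ[X]} (hp : p.natDegree ≤ d) (g : ℝ[X]) :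
    (bAddConv b n p g).natDegree ≤ d := by
  refine natDegree_sum_le_of_forall_le _ _ fun k _ => ?_
  refine (natDegree_mul_C_le _ _).trans ((natDegree_finDiff_iterate_le hb hp k).trans ?_)
  omega

/-- Terms with `k > 0` do not reach degree `d`. When `g` has degree exactly `n`, the remaining
factor is nonzero, so `T_g` preserves degrees. -/
theorem coeff_bAddConv (hb : b ≠ 0) {n d : ℕ} {p g : ℝ[X]} (hp : p.natDegree ≤ d)
    (hg : g.natDegree ≤ n) :
    (bAddConv b n p g).coeff d = p.coeff d * (n.factorial * g.coeff n) := by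
  rw [bAddConv, Finset.sum_range_succ', coeff_add, finsetSum_coeff, Finset.sum_eq_zero]
  · rw [zero_add, Function.iterate_zero_apply, Nat.sub_zero, finDiff_iterate_natDegree hb hg, eval_C,
      coeff_mul_C]
  · intro k _
    rw [coeff_mul_C]
    rcases Nat.eq_zero_or_pos d with rfl | hd
    · rw [finDiff_iterate_eq_zero hb hp (Nat.succ_pos k)]; simp
    · have := natDegree_finDiff_iterate_le hb hp (k + 1)
      rw [coeff_eq_zero_of_natDegree_lt (by omega), zero_mul]

theorem bAddConv_ne_zero (hb : b ≠ 0) {n : ℕ} {p g : ℝ[X]} (hp : p ≠ 0) (hg0 : g ≠ 0)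
    (hg : g.natDegree = n) : bAddConv b n p g ≠ 0 := by
  intro h
  have := coeff_bAddConv (n := n) hb le_rfl hg.le (p := p)
  rw [h, coeff_zero, ← hg] at this
  have h1 : p.coeff p.natDegree ≠ 0 := by simpa using hp
  have h2 : g.coeff g.natDegree ≠ 0 := by simpa using hg0
  have h3 : (g.natDegree.factorial : ℝ) ≠ 0 := by exact_mod_cast Nat.factorial_ne_zero _
  exact mul_ne_zero h1 (mul_ne_zero h3 h2) this.symm

theorem natDegree_bAddConv (hb : b ≠ 0) {n : ℕ} {p g : ℝ[X]} (hp : p ≠ 0) (hg0 : g ≠ 0)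
    (hg : g.natDegree = n) : (bAddConv b n p g).natDegree = p.natDegree := by
  refine le_antisymm (natDegree_bAddConv_le hb le_rfl g) (le_natDegree_of_ne_zero ?_)
  rw [coeff_bAddConv hb le_rfl hg.le, ← hg]
  have h1 : p.coeff p.natDegree ≠ 0 := by simpa using hp
  have h2 : g.coeff g.natDegree ≠ 0 := by simpa using hg0
  have h3 : (g.natDegree.factorial : ℝ) ≠ 0 := by exact_mod_cast Nat.factorial_ne_zero _
  exact mul_ne_zero h1 (mul_ne_zero h3 h2)

end Convolution

/-! ### Simple real roots, Lagrange interpolation and Wronskians -/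

section SimpleRoots

/-- The monic polynomial with simple roots at the points of `S`. -/
def rootPoly (S : Finset ℝ) : ℝ[X] := ∏ a ∈ S, (X - C a)

theorem rootPoly_monic (S : Finset ℝ) : (rootPoly S).Monic :=
  monic_prod_of_monic _ _ fun a _ => monic_X_sub_C a

theorem natDegree_rootPoly (S : Finset ℝ) : (rootPoly S).natDegree = S.card := by
  rw [rootPoly, natDegree_prod_of_monic _ _ fun a _ => monic_X_sub_C a]
  simp

theorem mul_rootPoly_erase {S : Finset ℝ} {a : ℝ} (ha : a ∈ S) :
    (X - C a) * rootPoly (S.erase a) = rootPoly S :=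
  Finset.mul_prod_erase S (fun a => X - C a) ha

theorem eval_rootPoly_eq_zero_iff {S : Finset ℝ} {x : ℝ} : (rootPoly S).eval x = 0 ↔ x ∈ S := by
  simp [rootPoly, eval_prod, Finset.prod_eq_zero_iff, sub_eq_zero]

theorem eval_derivative_rootPoly {S : Finset ℝ} {a : ℝ} (ha : a ∈ S) :
    (derivative (rootPoly S)).eval a = (rootPoly (S.erase a)).eval a := by
  rw [← mul_rootPoly_erase ha]; simp

theorem eval_derivative_C_mul_rootPoly {S : Finset ℝ} {a : ℝ} (k : ℝ) (ha : a ∈ S) :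
    (derivative (C k * rootPoly S)).eval a = (C k * rootPoly (S.erase a)).eval a := by
  simp [eval_derivative_rootPoly ha]

theorem eval_rootPoly_erase_ne_zero (S : Finset ℝ) (a : ℝ) : (rootPoly (S.erase a)).eval a ≠ 0 := by
  rw [Ne, eval_rootPoly_eq_zero_iff]; simp

theorem natDegree_C_mul_rootPoly {k : ℝ} (hk : k ≠ 0) (S : Finset ℝ) :
    (C k * rootPoly S).natDegree = S.card := by
  rw [natDegree_C_mul hk, natDegree_rootPoly]

theorem C_mul_rootPoly_ne_zero {k : ℝ} (hk : k ≠ 0) (S : Finset ℝ) : C k * rootPoly S ≠ 0 :=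
  mul_ne_zero (C_ne_zero.2 hk) (rootPoly_monic S).ne_zero

/-- Lagrange interpolation at the roots of a polynomial with simple real roots. -/
theorem eq_sum_rootPoly_erase {k : ℝ} (hk : k ≠ 0) {S : Finset ℝ} {r : ℝ[X]}
    (hr : r.natDegree ≤ S.card) :
    r = C (r.coeff S.card / k) * (C k * rootPoly S) +
      ∑ a ∈ S, C (r.eval a / (derivative (C k * rootPoly S)).eval a) *
        (C k * rootPoly (S.erase a)) := by
  have hlead : (rootPoly S).coeff S.card = 1 := by
    have := (rootPoly_monic S).coeff_natDegree
    rwa [natDegree_rootPoly] at this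
  rw [← sub_eq_iff_eq_add']
  refine eq_of_degrees_lt_of_eval_finset_eq S ?_ ?_ ?_
  · rw [degree_lt_iff_coeff_zero]
    intro i hi
    rw [coeff_sub, coeff_C_mul, coeff_C_mul]
    rcases eq_or_lt_of_le hi with h | h
    · rw [← h, hlead]; field_simp; simp
    · rw [coeff_eq_zero_of_natDegree_lt (by omega),
        coeff_eq_zero_of_natDegree_lt (p := rootPoly S) (by rw [natDegree_rootPoly]; omega)]
      simp
  · rw [degree_lt_iff_coeff_zero]
    intro i hi
    rw [finsetSum_coeff]
    refine Finset.sum_eq_zero fun a ha => ?_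
    have h1 := Finset.card_erase_lt_of_mem ha
    rw [coeff_C_mul, coeff_C_mul,
      coeff_eq_zero_of_natDegree_lt (p := rootPoly (S.erase a))
        (by rw [natDegree_rootPoly]; exact h1.trans_le hi)]
    simp
  · intro x hx
    rw [eval_finsetSum, Finset.sum_eq_single x]
    · rw [eval_derivative_C_mul_rootPoly k hx]
      simp only [eval_sub, eval_mul, eval_C, eval_rootPoly_eq_zero_iff.2 hx]
      have := eval_rootPoly_erase_ne_zero S x
      field_simp
      ring
    · intro a _ hax
      have : (rootPoly (S.erase a)).eval x = 0 :=
        eval_rootPoly_eq_zero_iff.2 (Finset.mem_erase.2 ⟨hax.symm, hx⟩)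
      simp [this]
    · exact fun h => absurd hx h

theorem interlacesLE_iff_wronskian {p q : ℝ[X]} :
    InterlacesLE p q ↔ ∀ x, 0 ≤ (wronskian p q).eval x := by
  refine forall_congr' fun x => ?_
  simp only [wronskian, eval_sub, eval_mul]
  constructor <;> intro h <;> linarith

/-- Antisymmetry of the Wronskian; it reduces statements about `f ≪ r` to statements about `-r ≪ f`.
-/
theorem interlacesLE_neg_iff {p q : ℝ[X]} : InterlacesLE (-p) q ↔ InterlacesLE q p := by
  refine forall_congr' fun x => ?_
  simp only [derivative_neg, eval_sub, eval_mul, eval_neg]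
  constructor <;> intro h <;> linarith

theorem wronskian_linear_mul (a : ℝ) (p : ℝ[X]) : wronskian p ((X - C a) * p) = p ^ 2 := by
  simp [wronskian]; ring

theorem wronskian_sum_left {ι : Type*} (s : Finset ι) (F : ι → ℝ[X]) (q : ℝ[X]) :
    wronskian (∑ i ∈ s, F i) q = ∑ i ∈ s, wronskian (F i) q := by
  simp only [wronskian, Finset.sum_mul, map_sum, Finset.sum_sub_distrib]

theorem wronskian_C_mul_left (c : ℝ) (p q : ℝ[X]) : wronskian (C c * p) q = C c * wronskian p q := by
  simp [wronskian]; ring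

/-- For `f` with simple real roots, `r ≪ f` is a sign condition at the roots of `f`. -/
theorem interlacesLE_iff_forall_roots {k : ℝ} (hk : k ≠ 0) {S : Finset ℝ} {r : ℝ[X]}
    (hr : r.natDegree ≤ S.card) :
    InterlacesLE r (C k * rootPoly S) ↔
      ∀ a ∈ S, 0 ≤ r.eval a * (derivative (C k * rootPoly S)).eval a := by
  constructor
  · intro h a ha
    have := h a
    simp only [eval_sub, eval_mul, eval_rootPoly_eq_zero_iff.2 ha] at this
    linarith
  · intro h
    rw [interlacesLE_iff_wronskian]
    intro x
    rw [eq_sum_rootPoly_erase hk hr, wronskian_add_left, wronskian_sum_left, wronskian_C_mul_left,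
      wronskian_self_eq_zero, mul_zero, zero_add, eval_finsetSum]
    refine Finset.sum_nonneg fun a ha => ?_
    -- Each generator `f/(x - a)` of the cone has Wronskian `(f/(x - a))²` with `f`.
    have h1 : wronskian (C k * rootPoly (S.erase a)) (C k * rootPoly S) =
        (C k * rootPoly (S.erase a)) ^ 2 := by
      rw [← wronskian_linear_mul a, ← mul_rootPoly_erase ha]; congr 1; ring
    rw [wronskian_C_mul_left, h1, eval_mul, eval_pow, eval_C]
    refine mul_nonneg ?_ (sq_nonneg _)
    rw [div_nonneg_iff, ← mul_nonneg_iff]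
    exact h a ha

/-- A real polynomial without roots off the real line splits. -/
theorem splits_of_aeval_ne_zero {p : ℝ[X]} (hp : ∀ z : ℂ, z.im ≠ 0 → aeval z p ≠ 0) :
    p.Splits := by
  refine Splits.of_splits_map (algebraMap ℝ ℂ) (IsAlgClosed.splits _) fun z hz => ?_
  have h0 : aeval z p = 0 := by
    rw [aeval_def, ← eval_map]; exact isRoot_of_mem_roots hz
  have him : z.im = 0 := by
    by_contra h
    exact hp z h h0
  exact ⟨z.re, Complex.ext (by simp) (by simp [him])⟩

theorem exists_eq_rootPoly {p : ℝ[X]} (hp : p ≠ 0) (hs : p.Splits)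
    (hd : ∀ x, p.eval x = 0 → (derivative p).eval x ≠ 0) :
    ∃ k : ℝ, k ≠ 0 ∧ ∃ S : Finset ℝ, p = C k * rootPoly S := by
  have hnd : p.roots.Nodup := by
    rw [Multiset.nodup_iff_count_le_one]
    intro a
    rw [count_roots]
    by_contra h
    push Not at h
    obtain ⟨h1, h2⟩ := (one_lt_rootMultiplicity_iff_isRoot hp).1 h
    exact hd a h1 h2
  refine ⟨p.leadingCoeff, leadingCoeff_ne_zero.2 hp, ⟨p.roots, hnd⟩, ?_⟩
  conv_lhs => rw [hs.eq_prod_roots]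
  rfl

/-- If `u` has simple real roots and `u ≪ v`, then `(x - a) u + v` is real-rooted. -/
theorem splits_linear_mul_add {k : ℝ} (hk : k ≠ 0) {S : Finset ℝ} {v : ℝ[X]} (a : ℝ)
    (hv : v.natDegree ≤ S.card) (h : InterlacesLE (C k * rootPoly S) v) :
    ((X - C a) * (C k * rootPoly S) + v).Splits := by
  refine splits_of_aeval_ne_zero fun z hz h0 => ?_
  set u := C k * rootPoly S with hu
  have hne : ∀ s : ℝ, z - s ≠ 0 := by
    intro s hs
    have := congrArg Complex.im hs
    simp at this
    exact hz this
  have hsgn : ∀ s ∈ S, v.eval s / (derivative u).eval s ≤ 0 := by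
    intro s hs
    have h1 := h s
    simp only [hu, eval_sub, eval_mul, eval_rootPoly_eq_zero_iff.2 hs] at h1
    rw [div_nonpos_iff, ← mul_nonpos_iff, hu]
    linarith
  have huz : aeval z u ≠ 0 := by
    rw [hu, rootPoly]
    simp only [map_mul, map_prod, aeval_C, map_sub, aeval_X]
    refine mul_ne_zero (by simpa using hk) (Finset.prod_ne_zero_iff.2 fun s _ => hne s)
  have hterm : ∀ s ∈ S, aeval z (C k * rootPoly (S.erase s)) = aeval z u / (z - s) := by
    intro s hs
    rw [eq_div_iff (hne s), hu, ← mul_rootPoly_erase hs]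
    simp
    ring
  -- Partial fractions: `v/u = c + ∑ c_s/(z - s)` with every `c_s ≤ 0`. Hence the imaginary part of
  -- `z - a + v/u` is `z.im` times a factor at least `1`.
  have hvz : aeval z v = aeval z u * ((v.coeff S.card / k : ℝ) +
      ∑ s ∈ S, ((v.eval s / (derivative u).eval s : ℝ) : ℂ) / (z - s)) := by
    conv_lhs => rw [eq_sum_rootPoly_erase hk hv]
    rw [map_add, map_mul, map_sum, mul_add, Finset.mul_sum, aeval_C]
    congr 1
    · exact mul_comm _ _
    · refine Finset.sum_congr rfl fun s hs => ?_
      rw [map_mul, hterm s hs, aeval_C]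
      simp only [Complex.coe_algebraMap]
      ring
  rw [map_add, map_mul, hvz, mul_comm, ← mul_add] at h0
  have h2 := (mul_eq_zero.1 h0).resolve_left huz
  have h3 := congrArg Complex.im h2
  simp only [map_sub, aeval_X, aeval_C, Complex.coe_algebraMap, Complex.add_im, Complex.sub_im,
    Complex.ofReal_im, Complex.im_sum, Complex.zero_im] at h3
  have h4 : ∀ s ∈ S, (((v.eval s / (derivative u).eval s : ℝ) : ℂ) / (z - s)).im =
      z.im * (-(v.eval s / (derivative u).eval s) / Complex.normSq (z - s)) := by
    intro s _
    rw [Complex.div_im]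
    simp only [Complex.ofReal_im, Complex.ofReal_re, Complex.sub_im]
    ring
  rw [Finset.sum_congr rfl h4, ← Finset.mul_sum] at h3
  have h5 : 0 ≤ ∑ s ∈ S, -(v.eval s / (derivative u).eval s) / Complex.normSq (z - s) :=
    Finset.sum_nonneg fun s hs =>
      div_nonneg (neg_nonneg.2 (hsgn s hs)) (Complex.normSq_nonneg _)
  have h6 : z.im * (1 + ∑ s ∈ S, -(v.eval s / (derivative u).eval s) / Complex.normSq (z - s)) = 0 := by
    linarith
  rcases mul_eq_zero.1 h6 with h7 | h7
  · exact hz h7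
  · linarith

end SimpleRoots

/-! ### Mesh polynomials and their differences -/

section Mesh

variable {b : ℝ}

/-- Distinct points of `S` are at distance at least `b`. -/
def HasGap (b : ℝ) (S : Finset ℝ) : Prop := ∀ x ∈ S, ∀ y ∈ S, x < y → x + b ≤ y

theorem HasGap.mono {S T : Finset ℝ} (hT : HasGap b T) (h : S ⊆ T) : HasGap b S :=
  fun x hx y hy => hT x (h hx) y (h hy)

theorem hasGap_zero (S : Finset ℝ) : HasGap 0 S := fun x _ y _ h => by linarith

theorem IsMesh.exists_rootPoly (hb : 0 < b) {p : ℝ[X]} (hp : IsMesh b p) :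
    ∃ k : ℝ, k ≠ 0 ∧ ∃ S : Finset ℝ, HasGap b S ∧ p = C k * rootPoly S := by
  obtain ⟨h0, hs, hd⟩ := hp
  have hnd : p.roots.Nodup := by
    rw [Multiset.nodup_iff_count_le_one]
    intro a
    by_contra h
    push Not at h
    have h1 : a ∈ p.roots := Multiset.count_pos.1 (by omega)
    have h2 : a ∈ p.roots.erase a := by
      rw [← Multiset.count_pos, Multiset.count_erase_self]; omega
    have := hd a h1 a h2
    simp at this
    linarith
  refine ⟨p.leadingCoeff, leadingCoeff_ne_zero.2 h0, ⟨p.roots, hnd⟩, ?_, ?_⟩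
  · intro x hx y hy hxy
    have := hd y hy x ((Multiset.mem_erase_of_ne hxy.ne).2 hx)
    rw [abs_of_pos (by linarith)] at this
    linarith
  · conv_lhs => rw [hs.eq_prod_roots]
    rfl

/-- Increasing enumeration of a finite set with gaps, continued with the same gaps. -/
theorem HasGap.exists_enumeration (hb : 0 ≤ b) {S : Finset ℝ} (hS : HasGap b S) :
    ∃ α : ℕ → ℝ, StrictMono α ∧ (∀ i, α i + b ≤ α (i + 1)) ∧
      S = (Finset.range S.card).image α := by
  classical
  induction S using Finset.induction_on_max with
  | empty =>
    refine ⟨fun i => i * (b + 1), strictMono_nat_of_lt_succ fun i => ?_, fun i => ?_, by simp⟩ <;>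
    · push_cast; linarith
  | insert a S ha ih =>
    obtain ⟨α, h1, h2, h3⟩ := ih (hS.mono (Finset.subset_insert a S))
    have haS : a ∉ S := fun h => lt_irrefl _ (ha a h)
    have hmem : ∀ i < S.card, α i ∈ S := fun i hi => by
      rw [h3]; exact Finset.mem_image_of_mem _ (Finset.mem_range.2 hi)
    -- Beyond `S` the increment is `b + 1`, which is positive also for `b = 0`.
    have step : ∀ i, (if i < S.card then α i else a + (i - S.card : ℝ) * (b + 1)) <
          (if i + 1 < S.card then α (i + 1) else a + ((i + 1 : ℕ) - S.card : ℝ) * (b + 1)) ∧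
        (if i < S.card then α i else a + (i - S.card : ℝ) * (b + 1)) + b ≤
          (if i + 1 < S.card then α (i + 1) else a + ((i + 1 : ℕ) - S.card : ℝ) * (b + 1)) := by
      intro i
      rcases lt_trichotomy (i + 1) S.card with h | h | h
      · rw [if_pos h, if_pos (by omega)]
        exact ⟨h1 (Nat.lt_succ_self i), h2 i⟩
      · rw [if_pos (by omega : i < S.card), if_neg (by omega), h]
        have hi := hmem i (by omega)
        have := hS (α i) (Finset.mem_insert_of_mem hi) a (Finset.mem_insert_self a S) (ha _ hi)
        simpa using ⟨ha _ hi, this⟩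
      · rw [if_neg (by omega), if_neg (by omega)]
        push_cast
        constructor <;> linarith
    refine ⟨fun i => if i < S.card then α i else a + (i - S.card : ℝ) * (b + 1),
      strictMono_nat_of_lt_succ fun i => (step i).1, fun i => (step i).2, ?_⟩
    rw [Finset.card_insert_of_notMem haS, Finset.range_add_one, Finset.image_insert]
    congr 1
    · simp
    · conv_lhs => rw [h3]
      refine Finset.image_congr fun i hi => ?_
      simp only [Finset.coe_range, Set.mem_Iio] at hi
      simp [hi]

theorem exists_root_of_mul_nonpos {p : ℝ[X]} {x y : ℝ} (hxy : x ≤ y)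
    (h : p.eval x * p.eval y ≤ 0) : ∃ z, x ≤ z ∧ z ≤ y ∧ p.eval z = 0 := by
  have hc : ContinuousOn (fun t => p.eval t) (Set.uIcc x y) := p.continuous.continuousOn
  have h0 : (0 : ℝ) ∈ Set.uIcc (p.eval x) (p.eval y) := by
    rw [Set.mem_uIcc]
    rcases mul_nonpos_iff.1 h with h | h
    · exact Or.inr ⟨h.2, h.1⟩
    · exact Or.inl h
  obtain ⟨z, hz, hz0⟩ := intermediate_value_uIcc hc h0
  rw [Set.uIcc_of_le hxy] at hz
  exact ⟨z, hz.1, hz.2, hz0⟩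

theorem eq_C_mul_rootPoly {p : ℝ[X]} (hp : p ≠ 0) {S : Finset ℝ} (hd : p.natDegree ≤ S.card)
    (h : ∀ a ∈ S, p.eval a = 0) : ∃ k : ℝ, k ≠ 0 ∧ p = C k * rootPoly S := by
  have h1 := eq_sum_rootPoly_erase one_ne_zero hd
  rw [Finset.sum_eq_zero fun a ha => by rw [h a ha]; simp, add_zero, C_1, one_mul, div_one] at h1
  refine ⟨_, ?_, h1⟩
  intro h0
  rw [h0] at h1
  exact hp (by simpa using h1)

theorem natDegree_finDiff_rootPoly (hb : 0 < b) {k : ℝ} (hk : k ≠ 0) {S : Finset ℝ} {m : ℕ}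
    (hm : S.card = m + 1) :
    (finDiff b (C k * rootPoly S)).natDegree = m ∧ finDiff b (C k * rootPoly S) ≠ 0 := by
  have hdeg := natDegree_C_mul_rootPoly hk S
  obtain ⟨h1, h2⟩ := coeff_finDiff_of_natDegree_le hb.ne' (n := m) (p := C k * rootPoly S)
    (by omega)
  have h3 : (C k * rootPoly S).coeff (m + 1) ≠ 0 := by
    rw [← hm, ← hdeg]
    exact leadingCoeff_ne_zero.2 (C_mul_rootPoly_ne_zero hk S)
  have h4 : (finDiff b (C k * rootPoly S)).coeff m ≠ 0 := by
    rw [h2]; exact mul_ne_zero (by positivity) h3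
  refine ⟨le_antisymm h1 (le_natDegree_of_ne_zero h4), fun h => h4 (by rw [h]; simp)⟩

/-- The finite difference of a `b`-mesh polynomial is `b`-mesh. -/
theorem exists_finDiff_eq_rootPoly (hb : 0 < b) {k : ℝ} (hk : k ≠ 0) {S : Finset ℝ} {m : ℕ}
    (hm : S.card = m + 1) (hS : HasGap b S) :
    ∃ l : ℝ, l ≠ 0 ∧ ∃ T : Finset ℝ, HasGap b T ∧ T.card = m ∧
      finDiff b (C k * rootPoly S) = C l * rootPoly T := by
  classical
  obtain ⟨hdeg, hne⟩ := natDegree_finDiff_rootPoly hb hk hm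
  obtain ⟨α, hα, hgap, himg⟩ := hS.exists_enumeration hb.le
  have hroot : ∀ i < m + 1, (C k * rootPoly S).eval (α i) = 0 := by
    intro i hi
    have : α i ∈ S := by
      rw [himg]; exact Finset.mem_image_of_mem _ (Finset.mem_range.2 (by omega))
    simp [eval_rootPoly_eq_zero_iff.2 this]
  -- The endpoint values of `Δ_b f` on `[α i + b, α (i + 1)]` are `f(α i + b)/b` and `-f(α (i + 1) -
  -- b)/b`, of weakly opposite signs. Consecutive such intervals are `b` apart, so the new roots
  -- inherit the gap. For `i ≥ m` the value is a filler.
  have hex : ∀ i, ∃ z, α i + b ≤ z ∧ z ≤ α (i + 1) ∧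
      (i < m → (finDiff b (C k * rootPoly S)).eval z = 0) := by
    intro i
    by_cases hi : i < m
    · obtain ⟨z, h1, h2, h3⟩ := exists_root_of_mul_nonpos
        (p := finDiff b (C k * rootPoly S)) (hgap i) (by
          rw [eval_finDiff, eval_finDiff, add_sub_cancel_right, hroot i (by omega),
            hroot (i + 1) (by omega)]
          -- Both points lie in `[α i, α (i + 1)]`, which has no root of `f` in its interior, so
          -- each linear factor has the same weak sign at both.
          have : 0 ≤ (rootPoly S).eval (α i + b) * (rootPoly S).eval (α (i + 1) - b) := by
            rw [rootPoly, eval_prod, eval_prod, ← Finset.prod_mul_distrib]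
            refine Finset.prod_nonneg fun x hx => ?_
            rw [himg] at hx
            obtain ⟨j, -, rfl⟩ := Finset.mem_image.1 hx
            simp only [eval_sub, eval_X, eval_C]
            have := hgap i
            rcases le_or_gt j i with h | h
            · have := hα.monotone h
              exact mul_nonneg (by linarith) (by linarith)
            · have := hα.monotone (show i + 1 ≤ j from h)
              exact mul_nonneg_of_nonpos_of_nonpos (by linarith) (by linarith)
          simp only [eval_mul, eval_C]
          have h2 := mul_nonneg (sq_nonneg (b⁻¹ * k)) this
          linarith)
      exact ⟨z, h1, h2, fun _ => h3⟩
    · exact ⟨α (i + 1), hgap i, le_rfl, fun h => absurd h hi⟩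
  choose β h1 h2 h3 using hex
  have hβ : ∀ i j, i < j → β i + b ≤ β j := by
    intro i j hij
    have := hα.monotone (show i + 1 ≤ j from hij)
    have := h1 j
    have := h2 i
    linarith
  have hβm : StrictMono β := fun i j hij => by have := hβ i j hij; linarith
  have hcard : ((Finset.range m).image β).card = m := by
    rw [Finset.card_image_of_injective _ hβm.injective, Finset.card_range]
  obtain ⟨l, hl, h⟩ := eq_C_mul_rootPoly hne (S := (Finset.range m).image β) (by omega) (by
    intro a ha
    obtain ⟨i, hi, rfl⟩ := Finset.mem_image.1 ha
    exact h3 i (Finset.mem_range.1 hi))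
  refine ⟨l, hl, _, ?_, hcard, h⟩
  intro x hx y hy hxy
  obtain ⟨i, -, rfl⟩ := Finset.mem_image.1 hx
  obtain ⟨j, -, rfl⟩ := Finset.mem_image.1 hy
  exact hβ i j (hβm.lt_iff_lt.1 hxy)

/-- At a root `a`, `Δ_b f(a) = -f(a - b)/b` is the value of `f/(x - a)` at `a - b`. By the gap, this
quotient has no root strictly between `a - b` and `a`, and its value at `a` is `f'(a)`. -/
theorem finDiff_interlacesLE (hb : 0 < b) {k : ℝ} (hk : k ≠ 0) {S : Finset ℝ}
    (hS : HasGap b S) : InterlacesLE (finDiff b (C k * rootPoly S)) (C k * rootPoly S) := by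
  have hdeg : (finDiff b (C k * rootPoly S)).natDegree ≤ S.card := by
    have := natDegree_finDiff_iterate_le hb.ne' (natDegree_C_mul_rootPoly hk S).le 1
    rw [Function.iterate_one] at this
    omega
  rw [interlacesLE_iff_forall_roots hk hdeg]
  intro a ha
  have h0 : (rootPoly S).eval (a - b) = -b * (rootPoly (S.erase a)).eval (a - b) := by
    rw [← mul_rootPoly_erase ha]; simp
  have h1 : 0 ≤ (rootPoly (S.erase a)).eval (a - b) * (rootPoly (S.erase a)).eval a := by
    rw [rootPoly, eval_prod, eval_prod, ← Finset.prod_mul_distrib]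
    refine Finset.prod_nonneg fun x hx => ?_
    obtain ⟨hxa, hx⟩ := Finset.mem_erase.1 hx
    simp only [eval_sub, eval_X, eval_C]
    rcases lt_or_gt_of_ne hxa with h | h
    · have := hS x hx a ha h
      exact mul_nonneg (by linarith) (by linarith)
    · exact mul_nonneg_of_nonpos_of_nonpos (by linarith) (by linarith)
  rw [eval_derivative_C_mul_rootPoly k ha, eval_finDiff]
  simp only [eval_mul, eval_C, eval_rootPoly_eq_zero_iff.2 ha, h0]
  have h2 := mul_nonneg (sq_nonneg k) h1
  have h3 : b⁻¹ * b = 1 := inv_mul_cancel₀ hb.ne'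
  calc (0 : ℝ) ≤ k ^ 2 * ((rootPoly (S.erase a)).eval (a - b) * (rootPoly (S.erase a)).eval a) := h2
    _ = (b⁻¹ * b) * (k ^ 2 *
        ((rootPoly (S.erase a)).eval (a - b) * (rootPoly (S.erase a)).eval a)) := by
      rw [h3, one_mul]
    _ = _ := by ring

/-- At a root of `Δ_b g` one has `g(x - b) = g(x)`, so the polar companion equals `(m + 1) g` there
and the sign comes from `Δ_b g ≪ g`. -/
theorem finDiff_interlacesLE_polarDiff (hb : 0 < b) {k : ℝ} (hk : k ≠ 0) {S : Finset ℝ} {m : ℕ}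
    (hm : S.card = m + 1) (hS : HasGap b S) :
    InterlacesLE (finDiff b (C k * rootPoly S)) (polarDiff b (m + 1) (C k * rootPoly S)) := by
  obtain ⟨l, hl, T, -, hT, h⟩ := exists_finDiff_eq_rootPoly hb hk hm hS
  have hdeg : (polarDiff b (m + 1) (C k * rootPoly S)).natDegree ≤ m :=
    natDegree_polarDiff_le hb.ne' (by rw [natDegree_C_mul_rootPoly hk, hm])
  rw [← interlacesLE_neg_iff, h,
    interlacesLE_iff_forall_roots hl (by rw [natDegree_neg, hT]; exact hdeg)]
  intro a ha
  have h0 : (finDiff b (C k * rootPoly S)).eval a = 0 := by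
    rw [h]; simp [eval_rootPoly_eq_zero_iff.2 ha]
  have h1 := finDiff_interlacesLE hb hk hS a
  rw [eval_sub, eval_mul, eval_mul (p := finDiff b _), h0, zero_mul, sub_zero, h] at h1
  have h2 : (polarDiff b (m + 1) (C k * rootPoly S)).eval a =
      (m + 1) * (C k * rootPoly S).eval a := by
    rw [polarDiff, comp_eq_sub_finDiff hb.ne', eval_sub, eval_mul, eval_mul, eval_sub,
      eval_mul (p := C b), h0]
    simp
  rw [eval_neg, h2]
  have h3 := mul_nonpos_of_nonneg_of_nonpos (by positivity : (0 : ℝ) ≤ m + 1) h1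
  linarith

end Mesh

/-! ### Convolution preserves interlacing and simple real roots -/

section ConvolutionInterlacing

variable {b : ℝ}

theorem bAddConv_eq_sum (b : ℝ) (n : ℕ) {k : ℝ} (hk : k ≠ 0) {S : Finset ℝ} {r : ℝ[X]}
    (hr : r.natDegree ≤ S.card) (g : ℝ[X]) :
    bAddConv b n r g = C (r.coeff S.card / k) * bAddConv b n (C k * rootPoly S) g +
      ∑ a ∈ S, C (r.eval a / (derivative (C k * rootPoly S)).eval a) *
        bAddConv b n (C k * rootPoly (S.erase a)) g := by
  simp only [← bAddConvLin_apply]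
  conv_lhs => rw [eq_sum_rootPoly_erase hk hr]
  simp only [map_add, map_sum, ← smul_eq_C_mul, map_smul]

/-- Passage from the generators to their cone. The hypothesis has the quantitative form supplied by
the induction; only the sign of the Wronskian matters here. -/
theorem bAddConv_interlacesLE_of_erase {k : ℝ} (hk : k ≠ 0) {S : Finset ℝ} {n : ℕ} {g : ℝ[X]}
    (h : ∀ a ∈ S, ∀ x, (bAddConv b n (C k * rootPoly (S.erase a)) g).eval x ^ 2 ≤
      (wronskian (bAddConv b n (C k * rootPoly (S.erase a)) g)
        (bAddConv b n (C k * rootPoly S) g)).eval x)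
    {r : ℝ[X]} (hr : r.natDegree ≤ S.card) (hrf : InterlacesLE r (C k * rootPoly S)) :
    InterlacesLE (bAddConv b n r g) (bAddConv b n (C k * rootPoly S) g) := by
  rw [interlacesLE_iff_wronskian]
  intro x
  rw [interlacesLE_iff_forall_roots hk hr] at hrf
  rw [bAddConv_eq_sum b n hk hr, wronskian_add_left, wronskian_sum_left, wronskian_C_mul_left,
    wronskian_self_eq_zero, mul_zero, zero_add, eval_finsetSum]
  refine Finset.sum_nonneg fun a ha => ?_
  rw [wronskian_C_mul_left, eval_mul, eval_C]
  refine mul_nonneg ?_ ((sq_nonneg _).trans (h a ha x))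
  rw [div_nonneg_iff, ← mul_nonneg_iff]
  exact hrf a ha

theorem wronskian_linear_mul_add (a : ℝ) (u v : ℝ[X]) :
    wronskian u ((X - C a) * u + v) = u ^ 2 + wronskian u v := by
  rw [wronskian_add_right, wronskian_linear_mul]

/-- Quantitative form of interlacing preservation for the generators `f / (x - a)` of the cone of
polynomials interlacing `f`. -/
theorem sq_le_wronskian_bAddConv (hb : 0 < b) (n : ℕ) {k l : ℝ} (hk : k ≠ 0) (hl : l ≠ 0)
    {S T : Finset ℝ} (hS : HasGap b S) (hT : HasGap b T) (hSn : S.card = n) (hTn : T.card = n) :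
    ∀ a ∈ S, ∀ x, (bAddConv b n (C k * rootPoly (S.erase a)) (C l * rootPoly T)).eval x ^ 2 ≤
      (wronskian (bAddConv b n (C k * rootPoly (S.erase a)) (C l * rootPoly T))
        (bAddConv b n (C k * rootPoly S) (C l * rootPoly T))).eval x := by
  induction n generalizing k l S T with
  | zero =>
    intro a ha
    rw [Finset.card_eq_zero.1 hSn] at ha
    exact absurd ha (Finset.notMem_empty a)
  | succ m ih =>
    intro a ha x
    have hcard : (S.erase a).card = m := by rw [Finset.card_erase_of_mem ha]; omega
    have hh : (C k * rootPoly (S.erase a)).natDegree = m := by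
      rw [natDegree_C_mul_rootPoly hk, hcard]
    have hf : C k * rootPoly S = (X - C a) * (C k * rootPoly (S.erase a)) := by
      rw [← mul_rootPoly_erase ha]; ring
    have hpd := natDegree_polarDiff_le hb.ne' (m := m) (g := C l * rootPoly T)
      (by rw [natDegree_C_mul_rootPoly hl, hTn])
    obtain ⟨l', hl', T', hgap, hT', hΔ⟩ := exists_finDiff_eq_rootPoly hb hl hTn hT
    have huv := finDiff_interlacesLE_polarDiff hb hl hTn hT
    have hS' := hS.mono (Finset.erase_subset a S)
    rw [hf, bAddConv_linear_mul hb.ne' a hh.le, wronskian_linear_mul_add, eval_add, eval_pow]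
    refine le_add_of_nonneg_right ?_
    revert x
    -- Commuting the factors exchanges the roles of `f` and `g`: the claim now concerns `T_h` at
    -- level `m` relative to `Δ_b g`.
    rw [← interlacesLE_iff_wronskian, bAddConv_succ_of_natDegree_le hb.ne' hh.le,
      bAddConv_comm hb.ne' hh.le hpd,
      bAddConv_comm hb.ne' hh.le (by rw [hΔ, natDegree_C_mul_rootPoly hl', hT'])]
    rw [hΔ] at huv ⊢
    rw [← interlacesLE_neg_iff] at huv ⊢
    have := bAddConv_interlacesLE_of_erase hl' (ih hl' hk hgap hS' hT' hcard)
      (r := -polarDiff b (m + 1) (C l * rootPoly T)) (by rw [natDegree_neg, hT']; exact hpd)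
      huv
    rwa [← bAddConvLin_apply b m _ (-_), map_neg, bAddConvLin_apply] at this

theorem bAddConv_interlacesLE (hb : 0 < b) {n : ℕ} {k l : ℝ} (hk : k ≠ 0) (hl : l ≠ 0)
    {S T : Finset ℝ} (hS : HasGap b S) (hT : HasGap b T) (hSn : S.card = n) (hTn : T.card = n)
    {r : ℝ[X]} (hr : r.natDegree ≤ n) (hrf : InterlacesLE r (C k * rootPoly S)) :
    InterlacesLE (bAddConv b n r (C l * rootPoly T))
      (bAddConv b n (C k * rootPoly S) (C l * rootPoly T)) :=
  bAddConv_interlacesLE_of_erase hk (sq_le_wronskian_bAddConv hb n hk hl hS hT hSn hTn)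
    (by rwa [hSn]) hrf

theorem bAddConv_neg_left (b : ℝ) (n : ℕ) (r g : ℝ[X]) :
    bAddConv b n (-r) g = -bAddConv b n r g := by
  simp only [← bAddConvLin_apply, map_neg]

theorem interlacesLE_bAddConv (hb : 0 < b) {n : ℕ} {k l : ℝ} (hk : k ≠ 0) (hl : l ≠ 0)
    {S T : Finset ℝ} (hS : HasGap b S) (hT : HasGap b T) (hSn : S.card = n) (hTn : T.card = n)
    {r : ℝ[X]} (hr : r.natDegree ≤ n) (hrf : InterlacesLE (C k * rootPoly S) r) :
    InterlacesLE (bAddConv b n (C k * rootPoly S) (C l * rootPoly T))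
      (bAddConv b n r (C l * rootPoly T)) := by
  rw [← interlacesLE_neg_iff] at hrf ⊢
  rw [← bAddConv_neg_left]
  exact bAddConv_interlacesLE hb hk hl hS hT hSn hTn (by rwa [natDegree_neg]) hrf

/-- At a multiple root the bound `sq_le_wronskian_bAddConv` makes the images of all `f/(x - a)`
vanish. The constant `1` is a combination of these quotients and `f`, so its image, a nonzero
constant, would vanish too. -/
theorem bAddConv_eq_rootPoly_of_splits (hb : 0 < b) {n : ℕ} {k l : ℝ} (hk : k ≠ 0) (hl : l ≠ 0)
    {S T : Finset ℝ} (hS : HasGap b S) (hT : HasGap b T) (hSn : S.card = n) (hTn : T.card = n)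
    (h : (bAddConv b n (C k * rootPoly S) (C l * rootPoly T)).Splits) :
    ∃ j : ℝ, j ≠ 0 ∧ ∃ U : Finset ℝ, U.card = n ∧
      bAddConv b n (C k * rootPoly S) (C l * rootPoly T) = C j * rootPoly U := by
  have hg0 := C_mul_rootPoly_ne_zero hl T
  have hgn : (C l * rootPoly T).natDegree = n := by rw [natDegree_C_mul_rootPoly hl, hTn]
  have hdeg : (bAddConv b n (C k * rootPoly S) (C l * rootPoly T)).natDegree = n := by
    rw [natDegree_bAddConv hb.ne' (C_mul_rootPoly_ne_zero hk S) hg0 hgn,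
      natDegree_C_mul_rootPoly hk, hSn]
  have hne : bAddConv b n (C k * rootPoly S) (C l * rootPoly T) ≠ 0 :=
    bAddConv_ne_zero hb.ne' (C_mul_rootPoly_ne_zero hk S) hg0 hgn
  obtain ⟨j, hj, U, hU⟩ := exists_eq_rootPoly hne h (by
    intro x hx hx'
    have hn : n ≠ 0 := by
      rintro rfl
      rw [eq_C_of_natDegree_eq_zero hdeg, eval_C] at hx
      rw [eq_C_of_natDegree_eq_zero hdeg, hx] at hne
      simp at hne
    have h0 : ∀ a ∈ S,
        (bAddConv b n (C k * rootPoly (S.erase a)) (C l * rootPoly T)).eval x = 0 := by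
      intro a ha
      have h1 := sq_le_wronskian_bAddConv hb n hk hl hS hT hSn hTn a ha x
      simp only [wronskian, eval_sub, eval_mul, hx, hx', mul_zero, sub_zero] at h1
      exact pow_eq_zero_iff two_ne_zero |>.1 (le_antisymm h1 (sq_nonneg _))
    have h1 := congrArg (eval x) (bAddConv_eq_sum b n hk (S := S) (r := 1) (by simp)
      (C l * rootPoly T))
    rw [eval_add, eval_mul, hx, eval_finsetSum,
      Finset.sum_eq_zero fun a ha => by rw [eval_mul, h0 a ha, mul_zero]] at h1
    have h2 : (bAddConv b n 1 (C l * rootPoly T)).natDegree = 0 := by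
      rw [natDegree_bAddConv hb.ne' one_ne_zero hg0 hgn, natDegree_one]
    have h3 := bAddConv_ne_zero hb.ne' one_ne_zero hg0 hgn
    rw [eq_C_of_natDegree_eq_zero h2] at h1 h3
    rw [eval_C, mul_zero, add_zero] at h1
    rw [h1] at h3
    simp at h3)
  refine ⟨j, hj, U, ?_, hU⟩
  rw [← hdeg, hU, natDegree_C_mul_rootPoly hj]

/-- The convolution of two `b`-mesh polynomials has simple real roots. -/
theorem bAddConv_eq_rootPoly (hb : 0 < b) (n : ℕ) {k l : ℝ} (hk : k ≠ 0) (hl : l ≠ 0)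
    {S T : Finset ℝ} (hS : HasGap b S) (hT : HasGap b T) (hSn : S.card = n) (hTn : T.card = n) :
    ∃ j : ℝ, j ≠ 0 ∧ ∃ U : Finset ℝ, U.card = n ∧
      bAddConv b n (C k * rootPoly S) (C l * rootPoly T) = C j * rootPoly U := by
  induction n generalizing k l S T with
  | zero =>
    refine bAddConv_eq_rootPoly_of_splits hb hk hl hS hT hSn hTn ?_
    have h : (bAddConv b 0 (C k * rootPoly S) (C l * rootPoly T)).natDegree = 0 := by
      rw [natDegree_bAddConv hb.ne' (C_mul_rootPoly_ne_zero hk S) (C_mul_rootPoly_ne_zero hl T)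
        (by rw [natDegree_C_mul_rootPoly hl, hTn]), natDegree_C_mul_rootPoly hk, hSn]
    rw [eq_C_of_natDegree_eq_zero h]
    exact Splits.C _
  | succ m ih =>
    refine bAddConv_eq_rootPoly_of_splits hb hk hl hS hT hSn hTn ?_
    obtain ⟨a, ha⟩ : S.Nonempty := Finset.card_pos.1 (by omega)
    have hcard : (S.erase a).card = m := by rw [Finset.card_erase_of_mem ha]; omega
    have hh : (C k * rootPoly (S.erase a)).natDegree = m := by
      rw [natDegree_C_mul_rootPoly hk, hcard]
    have hf : C k * rootPoly S = (X - C a) * (C k * rootPoly (S.erase a)) := by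
      rw [← mul_rootPoly_erase ha]; ring
    have hpd := natDegree_polarDiff_le hb.ne' (m := m) (g := C l * rootPoly T)
      (by rw [natDegree_C_mul_rootPoly hl, hTn])
    obtain ⟨l', hl', T', hgap, hT', hΔ⟩ := exists_finDiff_eq_rootPoly hb hl hTn hT
    have huv := finDiff_interlacesLE_polarDiff hb hl hTn hT
    have hS' := hS.mono (Finset.erase_subset a S)
    -- By induction `u` has simple real roots, which `splits_linear_mul_add` needs besides `u ≪ v`.
    obtain ⟨j, hj, U, hU, hu⟩ := ih hl' hk hgap hS' hT' hcard
    rw [hΔ] at huv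
    have h := interlacesLE_bAddConv hb hl' hk hgap hS' hT' hcard hpd huv
    rw [hf, bAddConv_linear_mul hb.ne' a hh.le, bAddConv_succ_of_natDegree_le hb.ne' hh.le,
      bAddConv_comm hb.ne' hh.le hpd,
      bAddConv_comm hb.ne' hh.le (by rw [hΔ, natDegree_C_mul_rootPoly hl', hT']), hΔ]
    rw [hu] at h ⊢
    exact splits_linear_mul_add hj a
      (by rw [hU]; exact natDegree_bAddConv_le hb.ne' hpd _) h

end ConvolutionInterlacing

/-! ### Alternating root sequences and their signs -/

section RootSequences

theorem rootsAlternate_of_seq {k l : ℝ} (hk : k ≠ 0) (hl : l ≠ 0) {d n : ℕ}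
    (hdn : d = n ∨ d = n + 1) (c : ℕ → ℝ) (hc : ∀ i, i + 1 < d + n → c i ≤ c (i + 1)) :
    RootsAlternate (C k * ∏ i ∈ Finset.range d, (X - C (c (2 * i))))
      (C l * ∏ i ∈ Finset.range n, (X - C (c (2 * i + 1)))) := by
  have hdeg : ∀ (e : ℝ) (_ : e ≠ 0) (N : ℕ) (u : ℕ → ℝ),
      (C e * ∏ i ∈ Finset.range N, (X - C (u i))).natDegree = N := by
    intro e he N u
    rw [natDegree_C_mul he, natDegree_prod_of_monic _ _ fun i _ => monic_X_sub_C (u i)]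
    simp
  have hne : ∀ (N : ℕ) (u : ℕ → ℝ), ∏ i ∈ Finset.range N, (X - C (u i)) ≠ 0 := fun N u =>
    Finset.prod_ne_zero_iff.2 fun i _ => X_sub_C_ne_zero _
  have hroots : ∀ (e : ℝ) (_ : e ≠ 0) (N : ℕ) (u : ℕ → ℝ),
      (C e * ∏ i ∈ Finset.range N, (X - C (u i))).roots = (Multiset.range N).map u := by
    intro e he N u
    rw [roots_C_mul _ he]
    have : ∏ i ∈ Finset.range N, (X - C (u i)) =
        (((Multiset.range N).map u).map fun a => X - C a).prod := by
      rw [Multiset.map_map]; rfl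
    rw [this, roots_multiset_prod_X_sub_C]
  refine ⟨mul_ne_zero (C_ne_zero.2 hk) (hne _ _), mul_ne_zero (C_ne_zero.2 hl) (hne _ _), ?_,
    -- Freezing `c` at the last index used makes it monotone on all of `ℕ`.
    fun i => c (min i (d + n - 1)), ?_, ?_, ?_⟩
  · rwa [hdeg k hk d fun i => c (2 * i), hdeg l hl n fun i => c (2 * i + 1)]
  · refine monotone_nat_of_le_succ fun i => ?_
    rcases lt_or_ge (i + 1) (d + n) with h | h
    · rw [min_eq_left (by omega), min_eq_left (by omega)]
      exact hc i h
    · rw [min_eq_right (by omega), min_eq_right (by omega)]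
  · rw [hdeg k hk d fun i => c (2 * i), hroots k hk d fun i => c (2 * i)]
    refine Multiset.map_congr rfl fun i hi => ?_
    rw [Multiset.mem_range] at hi
    dsimp only
    rw [min_eq_left (by omega)]
  · rw [hdeg l hl n fun i => c (2 * i + 1), hroots l hl n fun i => c (2 * i + 1)]
    refine Multiset.map_congr rfl fun i hi => ?_
    rw [Multiset.mem_range] at hi
    dsimp only
    rw [min_eq_left (by omega)]

theorem RootsAlternate.exists_seq {p q : ℝ[X]} (h : RootsAlternate p q) :
    ∃ k l : ℝ, k ≠ 0 ∧ l ≠ 0 ∧ ∃ d n : ℕ, (d = n ∨ d = n + 1) ∧ ∃ c : ℕ → ℝ, Monotone c ∧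
      p = C k * ∏ i ∈ Finset.range d, (X - C (c (2 * i))) ∧
      q = C l * ∏ i ∈ Finset.range n, (X - C (c (2 * i + 1))) := by
  obtain ⟨hp, hq, hd, c, hc, h1, h2⟩ := h
  refine ⟨p.leadingCoeff, q.leadingCoeff, leadingCoeff_ne_zero.2 hp, leadingCoeff_ne_zero.2 hq,
    p.natDegree, q.natDegree, hd, c, hc, ?_, ?_⟩
  · conv_lhs => rw [← C_leadingCoeff_mul_prod_multiset_X_sub_C (p := p) (by rw [h1]; simp), h1,
      Multiset.map_map]
    rfl
  · conv_lhs => rw [← C_leadingCoeff_mul_prod_multiset_X_sub_C (p := q) (by rw [h2]; simp), h2,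
      Multiset.map_map]
    rfl

theorem prod_range_insert {M : Type*} [CommMonoid M] (F : ℝ → M) {a : ℝ} {u v : ℕ → ℝ} {m d : ℕ}
    (hmd : m ≤ d) (h1 : ∀ i < m, v i = u i) (h2 : v m = a) (h3 : ∀ i, m ≤ i → v (i + 1) = u i) :
    ∏ i ∈ Finset.range (d + 1), F (v i) = F a * ∏ i ∈ Finset.range d, F (u i) := by
  induction d, hmd using Nat.le_induction with
  | base =>
    rw [Finset.prod_range_succ, h2, mul_comm]
    congr 1
    exact Finset.prod_congr rfl fun i hi => by rw [h1 i (Finset.mem_range.1 hi)]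
  | succ d hd ih =>
    rw [Finset.prod_range_succ, ih, h3 d hd, Finset.prod_range_succ _ d, mul_assoc]

/-- Interlacing is preserved by multiplication with a common linear factor. -/
theorem RootsAlternate.linear_mul {p q : ℝ[X]} (h : RootsAlternate p q) (a : ℝ) :
    RootsAlternate ((X - C a) * p) ((X - C a) * q) := by
  obtain ⟨k, l, hk, hl, d, n, hdn, c, hc, rfl, rfl⟩ := h.exists_seq
  obtain ⟨j, hj, hj1, hj2⟩ : ∃ j ≤ d + n, (∀ i < j, c i ≤ a) ∧ ∀ i, j ≤ i → i < d + n → a ≤ c i := by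
    by_cases h : ∃ i, i < d + n ∧ a ≤ c i
    · classical
      refine ⟨Nat.find h, (Nat.find_spec h).1.le, fun i hi => ?_, fun i hi _ =>
        (Nat.find_spec h).2.trans (hc hi)⟩
      have h1 := Nat.find_min h hi
      have h2 := (Nat.find_spec h).1
      push Not at h1
      exact (h1 (by omega)).le
    · push Not at h
      exact ⟨d + n, le_rfl, fun i hi => (h i hi).le, fun i h1 h2 => by omega⟩
  -- Two adjacent copies of `a` in the merged list put one copy into each sequence and preserve the
  -- parity of all later indices.
  set c' : ℕ → ℝ := fun i => if i < j then c i else if i < j + 2 then a else c (i - 2) with hc'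
  have hmono : ∀ i, i + 1 < (d + 1) + (n + 1) → c' i ≤ c' (i + 1) := by
    intro i hi
    simp only [hc']
    rcases lt_trichotomy (i + 1) j with h | h | h
    · rw [if_pos (by omega : i < j), if_pos h]; exact hc (Nat.le_succ i)
    · rw [if_pos (by omega : i < j), if_neg (by omega : ¬ i + 1 < j),
        if_pos (by omega : i + 1 < j + 2)]
      exact hj1 i (by omega)
    · rw [if_neg (by omega : ¬ i < j), if_neg (by omega : ¬ i + 1 < j)]
      rcases lt_trichotomy (i + 1) (j + 2) with h' | h' | h'
      · rw [if_pos (by omega : i < j + 2), if_pos h']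
      · rw [if_pos (by omega : i < j + 2), if_neg (by omega : ¬ i + 1 < j + 2)]
        exact hj2 _ (by omega) (by omega)
      · rw [if_neg (by omega : ¬ i < j + 2), if_neg (by omega : ¬ i + 1 < j + 2)]
        exact hc (by omega)
  have key := rootsAlternate_of_seq hk hl (d := d + 1) (n := n + 1) (by omega) c' hmono
  rw [prod_range_insert (fun x => X - C x) (v := fun i => c' (2 * i)) (u := fun i => c (2 * i))
      (a := a) (m := (j + 1) / 2) (by omega)
      (fun i hi => by simp only [hc']; rw [if_pos (by omega)])
      (by simp only [hc']; rw [if_neg (by omega), if_pos (by omega)])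
      (fun i hi => by
        simp only [hc']; rw [if_neg (by omega), if_neg (by omega)]; congr 1),
    prod_range_insert (fun x => X - C x) (v := fun i => c' (2 * i + 1))
      (u := fun i => c (2 * i + 1)) (a := a) (m := j / 2) (by omega)
      (fun i hi => by simp only [hc']; rw [if_pos (by omega)])
      (by simp only [hc']; rw [if_neg (by omega), if_pos (by omega)])
      (fun i hi => by
        simp only [hc']; rw [if_neg (by omega), if_neg (by omega)]; congr 1)] at key
  convert key using 1 <;> ring

theorem prod_range_even_mul_odd {M : Type*} [CommMonoid M] (F : ℕ → M) {d n : ℕ}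
    (hdn : d = n ∨ d = n + 1) :
    (∏ i ∈ Finset.range d, F (2 * i)) * ∏ i ∈ Finset.range n, F (2 * i + 1) =
      ∏ i ∈ Finset.range (d + n), F i := by
  have h0 : (∏ i ∈ Finset.range n, F (2 * i)) * ∏ i ∈ Finset.range n, F (2 * i + 1) =
      ∏ i ∈ Finset.range (n + n), F i := by
    induction n generalizing d with
    | zero => simp
    | succ n ih =>
      rw [Finset.prod_range_succ, Finset.prod_range_succ _ n,
        show n + 1 + (n + 1) = n + n + 1 + 1 by ring, Finset.prod_range_succ,
        Finset.prod_range_succ _ (n + n), ← ih (Or.inl rfl), two_mul]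
      simp only [mul_assoc, mul_left_comm, mul_comm]
  rcases hdn with rfl | rfl
  · exact h0
  · rw [Finset.prod_range_succ, mul_right_comm, h0, show n + 1 + n = n + n + 1 by ring,
      Finset.prod_range_succ, two_mul]

/-- The factors `c l - c i` with `i > l` are nonpositive; their number `N - 1 - l` has the parity of
`N + 1 + l`. -/
theorem derivative_prod_range_sign {c : ℕ → ℝ} (hc : Monotone c) {N l : ℕ} (hl : l < N) :
    0 ≤ (-1) ^ (N + 1 + l) *
      (derivative (∏ i ∈ Finset.range N, (X - C (c i)))).eval (c l) := by
  have h1 : (derivative (∏ i ∈ Finset.range N, (X - C (c i)))).eval (c l) =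
      ∏ i ∈ (Finset.range N).erase l, (c l - c i) := by
    rw [← Finset.mul_prod_erase _ _ (Finset.mem_range.2 hl)]
    simp [eval_prod]
  rw [h1]
  clear h1
  induction N with
  | zero => omega
  | succ N ih =>
    rcases eq_or_lt_of_le (Nat.le_of_lt_succ hl) with rfl | h
    · rw [Even.neg_one_pow ⟨l + 1, by ring⟩, one_mul]
      refine Finset.prod_nonneg fun i hi => sub_nonneg.2 (hc ?_)
      have := Finset.mem_range.1 (Finset.mem_of_mem_erase hi)
      omega
    · rw [Finset.range_add_one, Finset.erase_insert_of_ne (by omega),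
        Finset.prod_insert (by simp)]
      have h2 := mul_nonneg (ih h) (sub_nonneg.2 (hc h.le))
      calc _ ≤ _ := h2
        _ = _ := by ring

/-- At a root of `p`, `q p' = (p q)'`. The roots of `p` occupy indices of a single parity in the
merged list, so the alternating sign is constant on them. -/
theorem sign_const_of_mul_eq_prod {p q : ℝ[X]} {K : ℝ} {c : ℕ → ℝ} (hc : Monotone c) {N e : ℕ}
    (hpq : p * q = C K * ∏ i ∈ Finset.range N, (X - C (c i)))
    (hp : ∀ a, p.eval a = 0 → ∃ i, 2 * i + e < N ∧ a = c (2 * i + e)) :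
    (∀ a, p.eval a = 0 → 0 ≤ q.eval a * (derivative p).eval a) ∨
      ∀ a, p.eval a = 0 → q.eval a * (derivative p).eval a ≤ 0 := by
  have key : ∀ a, p.eval a = 0 → ∃ t : ℝ, 0 ≤ t ∧
      q.eval a * (derivative p).eval a = K * (-1) ^ (N + 1 + e) * t := by
    intro a ha
    obtain ⟨i, hi, rfl⟩ := hp a ha
    refine ⟨_, derivative_prod_range_sign hc hi, ?_⟩
    have h2 := congrArg (fun f => (derivative f).eval (c (2 * i + e))) hpq
    simp only [derivative_mul, derivative_C, zero_mul, zero_add, eval_add, eval_mul, ha, add_zero,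
      eval_C] at h2
    rw [mul_comm, h2, show N + 1 + (2 * i + e) = N + 1 + e + 2 * i by ring, pow_add _ _ (2 * i),
      pow_mul, neg_one_sq, one_pow, mul_one]
    have h3 : ((-1 : ℝ) ^ (N + 1 + e)) * (-1) ^ (N + 1 + e) = 1 := by
      rw [← pow_add]; exact Even.neg_one_pow ⟨_, rfl⟩
    linear_combination (-K * (derivative (∏ i ∈ Finset.range N, (X - C (c i)))).eval
      (c (2 * i + e))) * h3
  rcases le_total 0 (K * (-1) ^ (N + 1 + e)) with h | h
  · refine Or.inl fun a ha => ?_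
    obtain ⟨t, ht, h1⟩ := key a ha
    rw [h1]; exact mul_nonneg h ht
  · refine Or.inr fun a ha => ?_
    obtain ⟨t, ht, h1⟩ := key a ha
    rw [h1]; exact mul_nonpos_of_nonpos_of_nonneg h ht

theorem exists_eq_of_eval_prod_eq_zero {k : ℝ} (hk : k ≠ 0) {d : ℕ} {u : ℕ → ℝ} {a : ℝ}
    (h : (C k * ∏ i ∈ Finset.range d, (X - C (u i))).eval a = 0) : ∃ i < d, a = u i := by
  rw [eval_mul, eval_C, eval_prod, mul_eq_zero_iff_left hk, Finset.prod_eq_zero_iff] at h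
  obtain ⟨i, hi, h⟩ := h
  exact ⟨i, Finset.mem_range.1 hi, by simpa [sub_eq_zero] using h⟩

theorem RootsAlternate.sign_left {p q : ℝ[X]} (h : RootsAlternate p q) :
    (∀ a, p.eval a = 0 → 0 ≤ q.eval a * (derivative p).eval a) ∨
      ∀ a, p.eval a = 0 → q.eval a * (derivative p).eval a ≤ 0 := by
  obtain ⟨k, l, hk, hl, d, n, hdn, c, hc, rfl, rfl⟩ := h.exists_seq
  refine sign_const_of_mul_eq_prod hc (K := k * l) (N := d + n) (e := 0) ?_ fun a ha => ?_
  · rw [← prod_range_even_mul_odd (fun i => X - C (c i)) hdn, C_mul]; ring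
  · obtain ⟨i, hi, rfl⟩ := exists_eq_of_eval_prod_eq_zero hk (u := fun i => c (2 * i)) ha
    exact ⟨i, by omega, rfl⟩

theorem RootsAlternate.sign_right {p q : ℝ[X]} (h : RootsAlternate p q) :
    (∀ a, q.eval a = 0 → 0 ≤ p.eval a * (derivative q).eval a) ∨
      ∀ a, q.eval a = 0 → p.eval a * (derivative q).eval a ≤ 0 := by
  obtain ⟨k, l, hk, hl, d, n, hdn, c, hc, rfl, rfl⟩ := h.exists_seq
  refine sign_const_of_mul_eq_prod hc (K := k * l) (N := d + n) (e := 1) ?_ fun a ha => ?_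
  · rw [← prod_range_even_mul_odd (fun i => X - C (c i)) hdn, C_mul]; ring
  · obtain ⟨i, hi, rfl⟩ := exists_eq_of_eval_prod_eq_zero hl (u := fun i => c (2 * i + 1)) ha
    exact ⟨i, by omega, rfl⟩

end RootSequences

/-! ### From sign conditions to interlacing roots -/

section SignsToRoots

theorem rootPoly_dvd {p : ℝ[X]} {S : Finset ℝ} (h : ∀ a ∈ S, p.eval a = 0) : rootPoly S ∣ p := by
  rcases eq_or_ne p 0 with rfl | hp
  · exact dvd_zero _
  · exact (Multiset.prod_X_sub_C_dvd_iff_le_roots hp S.val).2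
      (Finset.val_le_iff_val_subset.2 fun a ha => (mem_roots hp).2 (h a ha))

theorem rootPoly_image_range {u : ℕ → ℝ} (hu : StrictMono u) (n : ℕ) :
    rootPoly ((Finset.range n).image u) = ∏ i ∈ Finset.range n, (X - C (u i)) :=
  Finset.prod_image fun _ _ _ _ h => hu.injective h

/-- The sequence `a₀, b₀, a₁, b₁, …`. -/
def mergeSeq (α β : ℕ → ℝ) (i : ℕ) : ℝ := if i % 2 = 0 then α (i / 2) else β (i / 2)

theorem mergeSeq_even (α β : ℕ → ℝ) (i : ℕ) : mergeSeq α β (2 * i) = α i := by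
  simp [mergeSeq]

theorem mergeSeq_odd (α β : ℕ → ℝ) (i : ℕ) : mergeSeq α β (2 * i + 1) = β i := by
  rw [mergeSeq, if_neg (by omega), show (2 * i + 1) / 2 = i by omega]

theorem mergeSeq_monotone {α β : ℕ → ℝ} (h1 : ∀ i, α i ≤ β i) (h2 : ∀ i, β i ≤ α (i + 1)) :
    Monotone (mergeSeq α β) := by
  refine monotone_nat_of_le_succ fun i => ?_
  rcases Nat.even_or_odd' i with ⟨j, rfl | rfl⟩
  · rw [mergeSeq_even, mergeSeq_odd]; exact h1 j
  · rw [mergeSeq_odd, show 2 * j + 1 + 1 = 2 * (j + 1) by ring, mergeSeq_even]; exact h2 j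

theorem exists_root_between {k : ℝ} {α : ℕ → ℝ} (hα : StrictMono α) {n : ℕ} {s : ℝ[X]}
    (h : ∀ i < n, 0 < s.eval (α i) *
      (derivative (C k * ∏ i ∈ Finset.range n, (X - C (α i)))).eval (α i)) {i : ℕ}
    (hi : i + 1 < n) : ∃ z, α i < z ∧ z < α (i + 1) ∧ s.eval z = 0 := by
  have h0 := h i (by omega)
  have h1 := h (i + 1) hi
  have s0 := derivative_prod_range_sign hα.monotone (N := n) (l := i) (by omega)
  have s1 := derivative_prod_range_sign hα.monotone (N := n) (l := i + 1) hi
  rw [derivative_C_mul, eval_mul, eval_C] at h0 h1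
  set x := (derivative (∏ i ∈ Finset.range n, (X - C (α i)))).eval (α i)
  set y := (derivative (∏ i ∈ Finset.range n, (X - C (α i)))).eval (α (i + 1))
  have hxy : x * y ≤ 0 := by
    have h2 := mul_nonneg s0 s1
    have h3 : ((-1 : ℝ) ^ (n + 1 + i)) * (-1) ^ (n + 1 + i) = 1 := by
      rw [← pow_add]; exact Even.neg_one_pow ⟨_, rfl⟩
    have h4 : (-1 : ℝ) ^ (n + 1 + i) * x * ((-1) ^ (n + 1 + (i + 1)) * y) = -(x * y) := by
      rw [← add_assoc, pow_succ]
      linear_combination (-(x * y)) * h3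
    linarith
  have hss : s.eval (α i) * s.eval (α (i + 1)) ≤ 0 := by
    by_contra hcon
    push Not at hcon
    have h2 := mul_pos h0 h1
    have h3 := mul_nonneg (mul_nonneg hcon.le (sq_nonneg k)) (neg_nonneg.2 hxy)
    nlinarith
  obtain ⟨z, hz1, hz2, hz⟩ := exists_root_of_mul_nonpos (hα (Nat.lt_succ_self i)).le hss
  refine ⟨z, lt_of_le_of_ne hz1 ?_, lt_of_le_of_ne hz2 ?_, hz⟩
  · rintro rfl; rw [hz, zero_mul] at h0; exact lt_irrefl _ h0
  · rintro rfl; rw [hz, zero_mul] at h1; exact lt_irrefl _ h1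

/-- For nonempty `S`, each gap of `S` contains a root of `s`. The degree bound leaves a cofactor of
degree at most one, and the signs force its root, if any, to one side of all of `S`. -/
theorem rootsInterlace_of_sign_pos {k : ℝ} (hk : k ≠ 0) {S : Finset ℝ} {s : ℝ[X]} (hs : s ≠ 0)
    (hd : s.natDegree ≤ S.card)
    (h : ∀ a ∈ S, 0 < s.eval a * (derivative (C k * rootPoly S)).eval a) :
    RootsInterlace s (C k * rootPoly S) := by
  classical
  obtain ⟨α, hα, -, himg⟩ := (hasGap_zero S).exists_enumeration le_rfl
  generalize S.card = n at hd himg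
  subst himg
  rw [rootPoly_image_range hα] at h ⊢
  have h' : ∀ i < n, 0 < s.eval (α i) *
      (derivative (C k * ∏ i ∈ Finset.range n, (X - C (α i)))).eval (α i) := fun i hi =>
    h _ (Finset.mem_image_of_mem _ (Finset.mem_range.2 hi))
  clear h
  have hex : ∀ i, ∃ z, α i < z ∧ z < α (i + 1) ∧ (i + 1 < n → s.eval z = 0) := by
    intro i
    by_cases hi : i + 1 < n
    · obtain ⟨z, h1, h2, h3⟩ := exists_root_between hα h' hi
      exact ⟨z, h1, h2, fun _ => h3⟩
    · obtain ⟨z, h1, h2⟩ := exists_between (hα (Nat.lt_succ_self i))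
      exact ⟨z, h1, h2, fun h => absurd h hi⟩
  choose β h1 h2 h3 using hex
  have hβ : StrictMono β := strictMono_nat_of_lt_succ fun i => (h2 i).trans (h1 (i + 1))
  have hmono := mergeSeq_monotone (fun i => (h1 i).le) fun i => (h2 i).le
  rcases n with _ | m
  · have hs0 : s = C (s.coeff 0) := eq_C_of_natDegree_eq_zero (by omega)
    have h0 : s.coeff 0 ≠ 0 := fun h => hs (by rw [hs0, h, C_0])
    have := rootsAlternate_of_seq h0 hk (d := 0) (n := 0) (Or.inl rfl) α (by omega)
    rw [hs0]
    exact Or.inl (by simpa using this)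
  obtain ⟨t, ht⟩ : ∏ i ∈ Finset.range m, (X - C (β i)) ∣ s := by
    rw [← rootPoly_image_range hβ]
    refine rootPoly_dvd fun a ha => ?_
    obtain ⟨i, hi, rfl⟩ := Finset.mem_image.1 ha
    exact h3 i (by have := Finset.mem_range.1 hi; omega)
  have ht0 : t ≠ 0 := by rintro rfl; exact hs (by rw [ht, mul_zero])
  have htd : t.natDegree ≤ 1 := by
    have hq0 : ∏ i ∈ Finset.range m, (X - C (β i)) ≠ 0 :=
      Finset.prod_ne_zero_iff.2 fun i _ => X_sub_C_ne_zero _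
    have := natDegree_mul hq0 ht0
    rw [← ht, natDegree_prod_of_monic _ _ fun i _ => monic_X_sub_C (β i)] at this
    simp at this
    omega
  obtain ⟨l, e, rfl⟩ := exists_eq_X_add_C_of_natDegree_le_one htd
  rcases eq_or_ne l 0 with rfl | hl
  · have he : e ≠ 0 := by rintro rfl; exact ht0 (by simp)
    have := rootsAlternate_of_seq hk he (d := m + 1) (n := m) (Or.inr rfl) _
      (fun i _ => hmono (Nat.le_succ i))
    simp only [mergeSeq_even, mergeSeq_odd] at this
    rw [ht]
    refine Or.inr ?_
    convert this using 1
    simp [mul_comm]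
  obtain ⟨γ, rfl⟩ : ∃ γ, e = -(l * γ) := ⟨-(e / l), by field_simp⟩
  have ht' : s = (C l * (X - C γ)) * ∏ i ∈ Finset.range m, (X - C (β i)) := by
    rw [ht, C_neg, C_mul]; ring
  -- The product `(∏ (x - β))(∏ (x - α))'` at `α i` is the derivative of the merged product at an
  -- even index, hence nonnegative; the strict sign passes to `k l (α i - γ)`.
  have hsign : ∀ i < m + 1, 0 < k * l * (α i - γ) := by
    intro i hi
    have h4 := h' i hi
    have h5 := derivative_prod_range_sign hmono (N := m + 1 + m) (l := 2 * i) (by omega)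
    rw [← prod_range_even_mul_odd (fun i => X - C (mergeSeq α β i)) (Or.inr rfl),
      Even.neg_one_pow ⟨m + 1 + i, by ring⟩, one_mul] at h5
    simp only [mergeSeq_even, mergeSeq_odd] at h5
    have h6 : (∏ i ∈ Finset.range (m + 1), (X - C (α i))).eval (α i) = 0 := by
      rw [eval_prod]
      exact Finset.prod_eq_zero (Finset.mem_range.2 hi) (by simp)
    rw [derivative_mul, eval_add, eval_mul, eval_mul, h6, zero_mul, add_zero] at h5
    rw [derivative_C_mul, eval_mul (p := C k), ht', eval_mul, eval_mul (p := C l), eval_sub, eval_X,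
      eval_C, eval_C, eval_C] at h4
    by_contra hcon
    push Not at hcon
    have := mul_nonpos_of_nonpos_of_nonneg hcon h5
    linarith
  rcases lt_or_gt_of_ne (mul_ne_zero hk hl) with hkl | hkl
  · have hγ : α m ≤ γ := by
      have := hsign m (by omega)
      nlinarith
    have := rootsAlternate_of_seq hk hl (d := m + 1) (n := m + 1) (Or.inl rfl)
      -- Here `γ` is the largest root and closes the merged list.
      (fun i => if i = 2 * m + 1 then γ else mergeSeq α β i) (by
        intro i hi
        rw [if_neg (by omega : ¬ i = 2 * m + 1)]
        split_ifs with h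
        · rw [show i = 2 * m by omega, mergeSeq_even]; exact hγ
        · exact hmono (Nat.le_succ i))
    refine Or.inr ?_
    convert this using 1
    · congr 1
      refine Finset.prod_congr rfl fun i _ => ?_
      rw [if_neg (by omega), mergeSeq_even]
    · rw [Finset.prod_range_succ, if_pos rfl, ht', mul_assoc, mul_comm (X - C γ)]
      congr 2
      refine Finset.prod_congr rfl fun i hi => ?_
      have := Finset.mem_range.1 hi
      rw [if_neg (by omega), mergeSeq_odd]
  · have hγ : γ ≤ α 0 := by
      have := hsign 0 (by omega)
      nlinarith
    have := rootsAlternate_of_seq hl hk (d := m + 1) (n := m + 1) (Or.inl rfl)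
      -- Here `γ` is the smallest root; it opens the list and shifts it by one, so `s` comes first.
      (fun i => if i = 0 then γ else mergeSeq α β (i - 1)) (by
        intro i hi
        rw [if_neg (by omega : ¬ i + 1 = 0), Nat.add_sub_cancel]
        split_ifs with h
        · rw [h, show (0 : ℕ) = 2 * 0 by rfl, mergeSeq_even]; exact hγ
        · exact hmono (by omega))
    refine Or.inl ?_
    convert this using 1
    · rw [Finset.prod_range_succ', if_pos (by omega), ht', mul_assoc, mul_comm (X - C γ)]
      congr 2
      refine Finset.prod_congr rfl fun i _ => ?_
      rw [if_neg (by omega), show 2 * (i + 1) - 1 = 2 * i + 1 by omega, mergeSeq_odd]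
    · congr 1
      refine Finset.prod_congr rfl fun i _ => ?_
      rw [if_neg (by omega), Nat.add_sub_cancel, mergeSeq_even]

theorem RootsInterlace.linear_mul {p q : ℝ[X]} (h : RootsInterlace p q) (a : ℝ) :
    RootsInterlace ((X - C a) * p) ((X - C a) * q) :=
  h.imp (fun h => h.linear_mul a) fun h => h.linear_mul a

/-- If `w` has simple real roots and `s ≪ w`, then the roots of `s` and `w` interlace. -/
theorem rootsInterlace_of_sign {k : ℝ} (hk : k ≠ 0) {S : Finset ℝ} {s : ℝ[X]} (hs : s ≠ 0)
    (hd : s.natDegree ≤ S.card)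
    (h : ∀ a ∈ S, 0 ≤ s.eval a * (derivative (C k * rootPoly S)).eval a) :
    RootsInterlace s (C k * rootPoly S) := by
  induction hn : S.card generalizing S s with
  | zero =>
    refine rootsInterlace_of_sign_pos hk hs hd fun a ha => ?_
    rw [Finset.card_eq_zero.1 hn] at ha
    exact absurd ha (Finset.notMem_empty a)
  | succ n ih =>
    by_cases hcom : ∃ a ∈ S, s.eval a = 0
    -- A common root is divided out. At any other root `x` this removes `(x - a)² > 0` from the
    -- product in the sign condition.
    · obtain ⟨a, ha, hsa⟩ := hcom
      obtain ⟨s₁, rfl⟩ := dvd_iff_isRoot.2 hsa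
      have hs₁ : s₁ ≠ 0 := by rintro rfl; exact hs (mul_zero _)
      have hcard : (S.erase a).card = n := by rw [Finset.card_erase_of_mem ha]; omega
      rw [natDegree_mul (X_sub_C_ne_zero a) hs₁, natDegree_X_sub_C] at hd
      have := ih (S := S.erase a) hs₁ (by omega) (by
        intro x hx
        obtain ⟨hxa, hxS⟩ := Finset.mem_erase.1 hx
        have h1 := h x hxS
        rw [eval_derivative_C_mul_rootPoly k hxS, ← mul_rootPoly_erase (S := S.erase x)
          (Finset.mem_erase.2 ⟨hxa.symm, ha⟩), Finset.erase_right_comm] at h1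
        rw [eval_derivative_C_mul_rootPoly k hx]
        simp only [eval_mul, eval_sub, eval_X, eval_C] at h1 ⊢
        have hxa0 := sub_ne_zero.2 hxa
        have h2 : 0 < (x - a) ^ 2 := by positivity
        refine nonneg_of_mul_nonneg_right (a := (x - a) ^ 2) ?_ h2
        linarith) hcard
      have h2 := this.linear_mul a
      rwa [mul_left_comm, mul_rootPoly_erase ha] at h2
    · push Not at hcom
      refine rootsInterlace_of_sign_pos hk hs hd fun a ha => lt_of_le_of_ne (h a ha) (Ne.symm ?_)
      refine mul_ne_zero (hcom a ha) ?_
      rw [eval_derivative_C_mul_rootPoly k ha, eval_mul, eval_C]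
      exact mul_ne_zero hk (eval_rootPoly_erase_ne_zero S a)

theorem InterlacesLE.rootsInterlace {k : ℝ} (hk : k ≠ 0) {S : Finset ℝ} {s : ℝ[X]} (hs : s ≠ 0)
    (hd : s.natDegree ≤ S.card) (h : InterlacesLE s (C k * rootPoly S)) :
    RootsInterlace s (C k * rootPoly S) :=
  rootsInterlace_of_sign hk hs hd ((interlacesLE_iff_forall_roots hk hd).1 h)

/-- Roots do not see the signs of leading coefficients, hence the two alternatives. -/
theorem RootsInterlace.interlacesLE {k : ℝ} (hk : k ≠ 0) {S : Finset ℝ} {r : ℝ[X]}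
    (hd : r.natDegree ≤ S.card) (h : RootsInterlace r (C k * rootPoly S)) :
    InterlacesLE r (C k * rootPoly S) ∨ InterlacesLE (-r) (C k * rootPoly S) := by
  have hz : ∀ a ∈ S, (C k * rootPoly S).eval a = 0 := fun a ha => by
    simp [eval_rootPoly_eq_zero_iff.2 ha]
  rw [interlacesLE_iff_forall_roots hk hd, interlacesLE_iff_forall_roots hk (by rwa [natDegree_neg])]
  simp only [eval_neg, neg_mul, neg_nonneg]
  exact (h.elim RootsAlternate.sign_right RootsAlternate.sign_left).imp
    (fun h a ha => h a (hz a ha)) fun h a ha => h a (hz a ha)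

theorem RootsInterlace.neg_left {p q : ℝ[X]} (h : RootsInterlace p q) : RootsInterlace (-p) q := by
  simpa only [RootsInterlace, RootsAlternate, roots_neg, natDegree_neg, ne_eq, neg_eq_zero] using h

end SignsToRoots

theorem natDegree_le_of_mem_degreeLE {n : ℕ} (r : degreeLE ℝ (n : WithBot ℕ)) :
    (r : ℝ[X]).natDegree ≤ n :=
  natDegree_le_iff_degree_le.2 (mem_degreeLE.1 r.2)

end

theorem theorem1p4 (b : ℝ) (hb : 0 < b) (n : ℕ) (f g : degreeLE ℝ (n : WithBot ℕ))
    (hfdeg : (f : ℝ[X]).natDegree = n) (hgdeg : (g : ℝ[X]).natDegree = n)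
    (hf : IsMesh b (f : ℝ[X])) (hg : IsMesh b (g : ℝ[X])) :
    PreservesInterlacing n ((degreeLE ℝ (n : WithBot ℕ)).subtype ∘ₗ convOp b n g) f ∧
    ∀ r : degreeLE ℝ (n : WithBot ℕ), RootsInterlace (r : ℝ[X]) f →
      RootsInterlace (convOp b n g r : ℝ[X]) (convOp b n g f : ℝ[X]) := by
  have hop : ∀ r : degreeLE ℝ (n : WithBot ℕ),
      (convOp b n g r : ℝ[X]) = bAddConv b n r g := fun _ => rfl
  obtain ⟨k, hk, S, hS, hfS⟩ := hf.exists_rootPoly hb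
  obtain ⟨l, hl, T, hT, hgT⟩ := hg.exists_rootPoly hb
  have hSn : S.card = n := by rw [← hfdeg, hfS, natDegree_C_mul_rootPoly hk]
  have hTn : T.card = n := by rw [← hgdeg, hgT, natDegree_C_mul_rootPoly hl]
  have hdeg := natDegree_le_of_mem_degreeLE (n := n)
  have hle : ∀ r : ℝ[X], r.natDegree ≤ n → InterlacesLE r f →
      InterlacesLE (bAddConv b n r g) (bAddConv b n f g) := by
    rw [hfS, hgT]
    exact fun r hr => bAddConv_interlacesLE hb hk hl hS hT hSn hTn hr
  refine ⟨fun r => ⟨hle r (hdeg r), ?_⟩, fun r hr => ?_⟩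
  · rw [LinearMap.comp_apply, LinearMap.comp_apply, Submodule.subtype_apply,
      Submodule.subtype_apply, hop, hop, hfS, hgT]
    exact interlacesLE_bAddConv hb hk hl hS hT hSn hTn (hdeg r)
  · obtain ⟨j, hj, U, hU, hw⟩ := bAddConv_eq_rootPoly hb n hk hl hS hT hSn hTn
    rw [← hfS, ← hgT] at hw
    have key : ∀ s : ℝ[X], s ≠ 0 → s.natDegree ≤ n → InterlacesLE s f →
        RootsInterlace (bAddConv b n s g) (bAddConv b n f g) := by
      intro s hs hsn hsf
      have h := hle s hsn hsf
      rw [hw] at h ⊢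
      refine h.rootsInterlace hj (bAddConv_ne_zero hb.ne' hs hg.1 hgdeg) ?_
      rw [natDegree_bAddConv hb.ne' hs hg.1 hgdeg, hU]
      exact hsn
    have hr0 : (r : ℝ[X]) ≠ 0 := hr.elim (fun h => h.1) fun h => h.2.1
    rw [hop, hop]
    rw [hfS] at hr
    rcases hr.interlacesLE hk (by rw [hSn]; exact hdeg r) with h | h <;> rw [← hfS] at h
    · exact key r hr0 (hdeg r) h
    · have := key (-r) (neg_ne_zero.2 hr0) (by rw [natDegree_neg]; exact hdeg r) h
      rw [bAddConv_neg_left] at this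
      simpa using this.neg_left
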